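/- There are absolute constants $c_1,c_2>0$ such that the following holds. Let $k\ge 1$, and consider the system $x_{t+1}=Ax_t+Bu_t+w_t$, $y_t=Cx_t+Du_t$ ($t\ge 0$), with $x_t,w_t\in\mathbb R^n$, $u_t\in\mathbb R^m$, $y_t\in\mathbb R^r$ and $\|A\|_2<1$ (spectral norm). For a real random variable let $\|X\|_{\psi_2}=\inf\{c>0:\mathbb E[\exp(X^2/c^2)]\le 2\}$, and for a random vector let $\|W\|_{\psi_2}=\sup_{\|v\|_2\le 1}\|W^Tv\|_{\psi_2}$. Put $\mathcal F_t=\sigma(x_0,w_0,\dots,w_{t-1})$. Let $\eta,\gamma>0$ and assume: (i) $\|x_0\|_{\psi_2}\le\eta$, and for all $t$, $\|w_t\|_{\psi_2}\le\eta$ conditionally on $\mathcal F_t$; (ii) for some $0\le p<\frac1{4k-2}$ there are independent Bernoulli$(p)$ variables $\xi_0,\xi_1,\dots$, with $\xi_t$ independent of $\mathcal F_t$ and $\{\xi_t=0\}\subseteq\{w_t=0\}$ for all $t$; (iii) the inputs $u_0,u_1,\dots$ are independent, $u_t\sim N(0,\gamma^2I_m)$, and the sequence $(u_t)_{t\ge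 0}$ is independent of $(\xi_t)_{t\ge 0}$. Let $q=1-(1-p)^{2k-1}$, and let $G_k^*=[D\ \ CB\ \ CAB\ \cdots\ CA^{2k-2}B]\in\mathbb R^{r\times 2km}$. Then $q<\frac12$. Moreover, let $\delta\in(0,1]$ and let $T$ be an integer with $T\ge c_1$ and $$T\ \ge\ c_1\,\frac{k}{(1-2q)^2}\Big[km\log\Big(\frac{km}{1-2q}\Big)+\log\Big(\frac r\delta\Big)\Big].$$ Then, with probability at least $1-\delta$, every minimizer $\hat G_k$ of $$G\ \mapsto\ \sum_{t=2k-1}^{T+2k-2}\big\|y_t-G\,[u_t^T\ u_{t-1}^T\ \cdots\ u_{t-2k+1}^T]^T\big\|_1\qquad\text{over } G\in\mathbb R^{r\times 2km}$$ satisfies $$\|G_k^*-\hat G_k\|_F\ \le\ c_2\,\frac{\|A^{2k-1}\|_2\,\|C\|_2\,\sqrt r}{(1-\|A\|_2)(1-2q)}\Big(\frac\eta\gamma+\sqrt m\,\|B\|_2\Big).$$ In particular, the same bound holds with $\|A\|_2^{2k-1}$ in place of $\|A^{2k-1}\|_2$. -/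

import Mathlib

open MeasureTheory ProbabilityTheory
open scoped ENNReal BigOperators

noncomputable section

/-- The sub-Gaussian norm `inf {c > 0 : 𝔼[exp (X² / c²)] ≤ 2}` of a real random variable,
equal to `∞` if no such `c` exists (that is, if `X` is not sub-Gaussian). -/
def psi2Norm {Ω : Type*} [MeasurableSpace Ω] (X : Ω → ℝ) (P : Measure Ω) : ℝ≥0∞ :=
  ⨅ (c : ℝ) (_ : 0 < c)
    (_ : ∫⁻ ω, ENNReal.ofReal (Real.exp (X ω ^ 2 / c ^ 2)) ∂P ≤ 2), ENNReal.ofReal c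

/-- The sub-Gaussian norm of a random vector: the supremum of the sub-Gaussian norms of `Wᵀ v`
over `‖v‖₂ ≤ 1`. -/
def vecPsi2Norm {Ω : Type*} [MeasurableSpace Ω] {d : ℕ}
    (W : Ω → EuclideanSpace ℝ (Fin d)) (P : Measure Ω) : ℝ≥0∞ :=
  ⨆ (v : EuclideanSpace ℝ (Fin d)) (_ : ‖v‖ ≤ 1), psi2Norm (fun ω => inner ℝ (W ω) v) P

/-- The random variable `(x₀, w₀, …, w_{t-1})`, which generates the σ-algebra `ℱ_t`. -/
def history {Ω : Type*} {d : ℕ} (x₀ : Ω → EuclideanSpace ℝ (Fin d))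
    (w : ℕ → Ω → EuclideanSpace ℝ (Fin d)) (t : ℕ) :
    Ω → EuclideanSpace ℝ (Fin d) × (Fin t → EuclideanSpace ℝ (Fin d)) :=
  fun ω => (x₀ ω, fun s => w s ω)

/-- `‖W‖_{ψ₂} ≤ η` conditionally on `H`: for almost every value `h` of `H`, the conditional law of
`W` given `H = h` has sub-Gaussian norm at most `η`. -/
def CondPsi2Le {Ω β : Type*} [MeasurableSpace Ω] [MeasurableSpace β] {d : ℕ}
    (P : Measure Ω) [IsFiniteMeasure P] (W : Ω → EuclideanSpace ℝ (Fin d)) (H : Ω → β)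
    (η : ℝ) : Prop :=
  ∀ᵐ h ∂(P.map H), vecPsi2Norm id (condDistrib W H P h) ≤ ENNReal.ofReal η

/-- The spectral norm: the operator norm with respect to Euclidean norms. -/
def specNorm {a b : ℕ} (M : Matrix (Fin a) (Fin b) ℝ) : ℝ :=
  ‖(Matrix.toEuclideanLin M).toContinuousLinearMap‖

/-- The Frobenius norm. -/
def frobNorm {α β : Type*} [Fintype α] [Fintype β] (M : Matrix α β ℝ) : ℝ :=
  √(∑ i, ∑ j, M i j ^ 2)

/-- The Markov parameter matrix `[D, CB, CAB, …, CA^{2k-2}B]`; the column `(j, l)` is the `l`-th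
column of the `j`-th block, `j = 0, …, 2k-1`. -/
def markovMatrix {n m r : ℕ} (k : ℕ) (A : Matrix (Fin n) (Fin n) ℝ) (B : Matrix (Fin n) (Fin m) ℝ)
    (C : Matrix (Fin r) (Fin n) ℝ) (D : Matrix (Fin r) (Fin m) ℝ) :
    Matrix (Fin r) (Fin (2 * k) × Fin m) ℝ :=
  Matrix.of fun i c => if c.1.val = 0 then D i c.2 else (C * A ^ (c.1.val - 1) * B) i c.2

/-- The stacked input `[u_tᵀ, u_{t-1}ᵀ, …, u_{t-2k+1}ᵀ]ᵀ`, used for `t ≥ 2k-1` only. -/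
def stackedInput {m : ℕ} (k : ℕ) (u : ℕ → EuclideanSpace ℝ (Fin m)) (t : ℕ) :
    Fin (2 * k) × Fin m → ℝ :=
  fun c => u (t - c.1.val) c.2

/-- The objective `∑_{t=2k-1}^{T+2k-2} ‖y_t - G U_t‖₁` of the `ℓ₁`-norm estimator. -/
def l1Loss {m r : ℕ} (k T : ℕ) (u : ℕ → EuclideanSpace ℝ (Fin m))
    (y : ℕ → EuclideanSpace ℝ (Fin r)) (G : Matrix (Fin r) (Fin (2 * k) × Fin m) ℝ) : ℝ :=
  ∑ t ∈ Finset.Icc (2 * k - 1) (T + 2 * k - 2),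
    ∑ i, |y t i - (G.mulVec (stackedInput k u t)) i|

/-- `G` is a solution to the `ℓ₁`-norm estimator. -/
def IsL1Estimate {m r : ℕ} (k T : ℕ) (u : ℕ → EuclideanSpace ℝ (Fin m))
    (y : ℕ → EuclideanSpace ℝ (Fin r)) (G : Matrix (Fin r) (Fin (2 * k) × Fin m) ℝ) : Prop :=
  ∀ G', l1Loss k T u y G ≤ l1Loss k T u y G'

end

/-! Write θ = 1 - 2q, U_t for the stacked input, and let σ_t be +1 if no attack occurs in the 2k-1
steps before t, and -1 otherwise; then σ_t = 1 has probability (1+θ)/2 > 1/2. At a clean time the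
residual of the true matrix is C A^(2k-1) x_(t-2k+1). At any other time the triangle inequality
loses at most |⟨Δ, U_t⟩|, where Δ is a row of the error. The ℓ₁ loss separates over rows, so
minimality gives ∑ σ_t |⟨Δ, U_t⟩| ≤ 2 ∑ |(C A^(2k-1) x_s)_i| (`signed_sum_row_le`). The theorem
follows from a lower bound for the left side and an upper bound for the right side.

Lower bound: in a fixed direction the signs are independent of the Gaussians, and times 2k apart
involve disjoint data, so exponential moments multiply along a residue class mod 2k and convexity of
exp averages the dependent classes (`measure_signed_sum_lt_le`). A union bound over integer vectors
and rounding make the bound uniform, of order θγT‖Δ‖ (`le_signed_sum_of_integer`,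
`le_signed_sum_of_energy`).

Upper bound: the accumulated output is at most the sum of the responses to x_0, to the inputs and to
the attacks, each geometrically summable in time (`sum_norm_recursion_le`). Inputs are controlled by
their energy, x_0 and attacks by a conditional exponential moment iterated along the filtration
(`measure_attack_response_gt_le`). The response bound depends on the output dimension r, not on n.

Each of the three bad events has probability at most δ/3; off them every minimizer is accurate
(`frobNorm_sub_le_of_good_event`). -/

/-! ### Independence and exponential moments -/

/-- Iterated integration against two independent random variables. -/
theorem lintegral_comp_of_indepFun {Ω β γ : Type*} [MeasurableSpace Ω] [MeasurableSpace β]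
    [MeasurableSpace γ] {P : Measure Ω} [IsFiniteMeasure P] {X : Ω → β} {Y : Ω → γ}
    (hX : Measurable X) (hY : Measurable Y) (h : IndepFun X Y P) {F : β → γ → ℝ≥0∞}
    (hF : Measurable (Function.uncurry F)) :
    ∫⁻ ω, F (X ω) (Y ω) ∂P = ∫⁻ ω', ∫⁻ ω, F (X ω) (Y ω') ∂P ∂P := by
  have h1 := (indepFun_iff_map_prod_eq_prod_map_map hX.aemeasurable hY.aemeasurable).1 h
  have h2 : ∫⁻ ω, F (X ω) (Y ω) ∂P
      = ∫⁻ z, Function.uncurry F z ∂(P.map fun ω => (X ω, Y ω)) := by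
    rw [lintegral_map hF (hX.prodMk hY)]; rfl
  rw [h2, h1, lintegral_prod_symm' _ hF, lintegral_map (by fun_prop) hY]
  refine lintegral_congr fun ω' => ?_
  rw [lintegral_map (by fun_prop) hX]
  rfl

/-- Functions of disjoint finite blocks of an independent family multiply in expectation. -/
theorem lintegral_prod_of_disjoint_blocks {Ω β ι : Type*} [MeasurableSpace Ω] [MeasurableSpace β]
    {P : Measure Ω} {X : ℕ → Ω → β} (hX : ∀ s, Measurable (X s)) (hind : iIndepFun X P)
    (I : Finset ι) (S : ι → Finset ℕ)
    (hS : ∀ i ∈ I, ∀ j ∈ I, i ≠ j → Disjoint (S i) (S j))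
    (F : ι → (ℕ → β) → ℝ≥0∞) (hF : ∀ i, Measurable (F i))
    (hdep : ∀ i ∈ I, ∀ z z', (∀ s ∈ S i, z s = z' s) → F i z = F i z') :
    ∫⁻ ω, ∏ i ∈ I, F i (fun s => X s ω) ∂P = ∏ i ∈ I, ∫⁻ ω, F i (fun s => X s ω) ∂P := by
  classical
  have : IsProbabilityMeasure P := hind.isProbabilityMeasure
  obtain ⟨ω₀⟩ : Nonempty Ω := nonempty_of_isProbabilityMeasure P
  -- Outside `R` the sequence is filled with its values at a fixed sample point; by `hdep` the
  -- filling does not matter.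
  let ext (R : Finset ℕ) (z : R → β) : ℕ → β := fun s => if h : s ∈ R then z ⟨s, h⟩ else X s ω₀
  have hext (R : Finset ℕ) : Measurable (ext R) := by
    refine measurable_pi_lambda _ fun s => ?_
    by_cases h : s ∈ R
    · simpa [ext, h] using measurable_pi_apply _
    · simp [ext, h]
  induction I using Finset.cons_induction with
  | empty => simp
  | cons j I hj ih =>
    have ih' := ih (fun i hi i' hi' => hS i (by simp [hi]) i' (by simp [hi']))
      (fun i hi => hdep i (by simp [hi]))
    simp only [Finset.prod_cons]
    rw [← ih']
    have hdisj : Disjoint (S j) (I.biUnion S) := by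
      rw [Finset.disjoint_biUnion_right]
      exact fun i hi => hS j (by simp) i (by simp [hi]) (fun h => hj (h ▸ hi))
    have hI := hind.indepFun_finset (S j) (I.biUnion S) hdisj hX
    have hI2 := hI.comp (φ := fun z => F j (ext _ z))
      (ψ := fun z => ∏ i ∈ I, F i (ext _ z)) ((hF j).comp (hext _))
      (Finset.measurable_prod _ fun i _ => (hF i).comp (hext _))
    have e1 : ((fun z => F j (ext _ z)) ∘ fun ω (i : S j) => X i ω)
        = fun ω => F j (fun s => X s ω) := by
      funext ω
      exact hdep j (by simp) _ _ fun s hs => by simp [ext, hs]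
    have e2 : ((fun z => ∏ i ∈ I, F i (ext _ z)) ∘ fun ω (i : I.biUnion S) => X i ω)
        = fun ω => ∏ i ∈ I, F i (fun s => X s ω) := by
      funext ω
      refine Finset.prod_congr rfl fun i hi => hdep i (by simp [hi]) _ _ fun s hs => ?_
      have : s ∈ I.biUnion S := Finset.mem_biUnion.2 ⟨i, hi, hs⟩
      simp only [ext, this, dif_pos]
    rw [e1, e2] at hI2
    exact lintegral_mul_eq_lintegral_mul_lintegral_of_indepFun
      ((hF j).comp (measurable_pi_lambda _ hX))
      (Finset.measurable_prod _ fun i _ => (hF i).comp (measurable_pi_lambda _ hX)) hI2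

/-- The exponential of a subconvex combination of random variables has expectation at most
`K ≥ 1` if each of them has. -/
theorem lintegral_exp_sum_le {Ω ι : Type*} [MeasurableSpace Ω] {P : Measure Ω}
    [IsProbabilityMeasure P] (I : Finset ι) (α : ι → ℝ) (hα : ∀ i ∈ I, 0 ≤ α i)
    (hα1 : ∑ i ∈ I, α i ≤ 1) (Y : ι → Ω → ℝ) (hY : ∀ i, Measurable (Y i)) {K : ℝ≥0∞} (hK : 1 ≤ K)
    (h : ∀ i ∈ I, ∫⁻ ω, ENNReal.ofReal (Real.exp (Y i ω)) ∂P ≤ K) :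
    ∫⁻ ω, ENNReal.ofReal (Real.exp (∑ i ∈ I, α i * Y i ω)) ∂P ≤ K := by
  have hpt (ω : Ω) : Real.exp (∑ i ∈ I, α i * Y i ω)
      ≤ (1 - ∑ i ∈ I, α i) + ∑ i ∈ I, α i * Real.exp (Y i ω) := by
    have hs : 0 ≤ 1 - ∑ i ∈ I, α i := by linarith
    -- The missing mass is placed at 0, where exp equals 1. Only convexity is used, so the `Y i` may
    -- be dependent.
    have := convexOn_exp.map_add_sum_le (t := I) (w := α) (p := fun i => Y i ω)
      (v := 1 - ∑ i ∈ I, α i) (q := 0) hα (by ring) (fun _ _ => trivial) hs trivial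
    simpa using this
  calc ∫⁻ ω, ENNReal.ofReal (Real.exp (∑ i ∈ I, α i * Y i ω)) ∂P
      ≤ ∫⁻ ω, (ENNReal.ofReal (1 - ∑ i ∈ I, α i)
          + ∑ i ∈ I, ENNReal.ofReal (α i) * ENNReal.ofReal (Real.exp (Y i ω))) ∂P := by
        refine lintegral_mono fun ω => ?_
        refine (ENNReal.ofReal_le_ofReal (hpt ω)).trans ?_
        rw [ENNReal.ofReal_add (by linarith)
          (Finset.sum_nonneg fun i hi => mul_nonneg (hα i hi) (Real.exp_pos _).le),
          ENNReal.ofReal_sum_of_nonneg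
          (fun i hi => mul_nonneg (hα i hi) (Real.exp_pos _).le)]
        refine add_le_add le_rfl (Finset.sum_le_sum fun i hi => ?_)
        rw [ENNReal.ofReal_mul (hα i hi)]
    _ = ENNReal.ofReal (1 - ∑ i ∈ I, α i)
          + ∑ i ∈ I, ENNReal.ofReal (α i) * ∫⁻ ω, ENNReal.ofReal (Real.exp (Y i ω)) ∂P := by
        rw [lintegral_add_left measurable_const, lintegral_finsetSum _ (by fun_prop)]
        simp only [lintegral_const, measure_univ, mul_one]
        congr 1
        exact Finset.sum_congr rfl fun i _ => lintegral_const_mul _ (by fun_prop)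
    _ ≤ ENNReal.ofReal (1 - ∑ i ∈ I, α i) * K + ∑ i ∈ I, ENNReal.ofReal (α i) * K := by
        refine add_le_add (le_mul_of_one_le_right' hK) (Finset.sum_le_sum fun i hi => ?_)
        gcongr
        exact h i hi
    _ = K := by
        rw [← Finset.sum_mul, ← add_mul, ← ENNReal.ofReal_sum_of_nonneg hα,
          ← ENNReal.ofReal_add (by linarith) (Finset.sum_nonneg hα)]
        simp

/-- Chernoff's bound in terms of a bound on the exponential moment. -/
theorem measure_gt_le_of_exp_moment {Ω : Type*} [MeasurableSpace Ω] {P : Measure Ω} {Y : Ω → ℝ}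
    (hY : Measurable Y) {b s ε : ℝ}
    (h : ∫⁻ ω, ENNReal.ofReal (Real.exp (Y ω)) ∂P ≤ ENNReal.ofReal (Real.exp b))
    (hbs : Real.exp (b - s) ≤ ε) : P {ω | s < Y ω} ≤ ENNReal.ofReal ε := by
  have h1 : ENNReal.ofReal (Real.exp s) * P {ω | s < Y ω} ≤ ENNReal.ofReal (Real.exp b) := by
    refine le_trans ?_ h
    refine le_trans ?_ (mul_meas_ge_le_lintegral₀ (by fun_prop) (ENNReal.ofReal (Real.exp s)))
    gcongr
    intro hω
    exact ENNReal.ofReal_le_ofReal (Real.exp_le_exp.2 (le_of_lt hω))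
  have h2 : P {ω | s < Y ω} = ENNReal.ofReal (Real.exp (-s)) *
      (ENNReal.ofReal (Real.exp s) * P {ω | s < Y ω}) := by
    rw [← mul_assoc, ← ENNReal.ofReal_mul (Real.exp_pos _).le, ← Real.exp_add]
    simp
  rw [h2]
  calc _ ≤ ENNReal.ofReal (Real.exp (-s)) * ENNReal.ofReal (Real.exp b) := by gcongr
    _ = ENNReal.ofReal (Real.exp (b - s)) := by
      rw [← ENNReal.ofReal_mul (Real.exp_pos _).le, ← Real.exp_add]; congr 2; ring
    _ ≤ _ := ENNReal.ofReal_le_ofReal hbs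

/-! ### Gaussian estimates and the law of the stacked input -/

/-- Since |e^(ix) - 1| ≤ |x|, the first absolute moment dominates |φ(1) - 1| = 1 - e^(-1/2), with φ
the characteristic function. -/
theorem one_third_le_integral_abs_gaussian : 1 / 3 ≤ ∫ x, |x| ∂(gaussianReal 0 1) := by
  have hint : Integrable (fun x : ℝ => x) (gaussianReal 0 1) :=
    (memLp_id_gaussianReal 1).integrable (by simp)
  have h1 : ‖charFun (gaussianReal 0 1) 1 - 1‖ ≤ ∫ x, |x| ∂(gaussianReal 0 1) := by
    have e : charFun (gaussianReal 0 1) 1 - 1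
        = ∫ x : ℝ, (Complex.exp (Complex.I * x) - 1) ∂(gaussianReal 0 1) := by
      rw [integral_sub, charFun_apply_real]
      · simp [mul_comm]
      · refine (integrable_const (1 : ℝ)).mono' (by fun_prop) (.of_forall fun x => ?_)
        rw [mul_comm, Complex.norm_exp_ofReal_mul_I]
      · exact integrable_const _
    rw [e]
    refine (norm_integral_le_integral_norm _).trans (integral_mono_of_nonneg
      (.of_forall fun _ => norm_nonneg _) hint.abs (.of_forall fun x => ?_))
    exact Real.norm_exp_I_mul_ofReal_sub_one_le
  refine le_trans ?_ h1
  rw [charFun_gaussianReal]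
  have h2 : Real.exp (-(1 / 2)) ≤ 2 / 3 := by
    rw [Real.exp_neg, inv_le_comm₀ (Real.exp_pos _) (by norm_num)]
    have := Real.add_one_le_exp (1 / 2 : ℝ)
    norm_num at this ⊢
    linarith
  have h3 : Complex.exp (1 * (0 : ℝ) * Complex.I - (1 : NNReal) * 1 ^ 2 / 2) - 1
      = ((Real.exp (-(1 / 2)) - 1 : ℝ) : ℂ) := by
    push_cast
    congr 2
    norm_num
  have h4 := Complex.norm_real (Real.exp (-(1 / 2)) - 1)
  rw [← h3] at h4
  norm_num at h4 h2 ⊢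
  rw [h4]
  rw [abs_of_neg (by linarith)]
  linarith

theorem integrable_exp_mul_abs_gaussian (t : ℝ) :
    Integrable (fun x : ℝ => Real.exp (t * |x|)) (gaussianReal 0 1) :=
  integrable_exp_mul_abs (X := fun x : ℝ => x) (by simpa using integrable_exp_mul_gaussianReal t)
    (by simpa using integrable_exp_mul_gaussianReal (-t))

/-- One step of the signed exponential moment: a sign that is positive with probability
`(1 + θ) / 2` leaves a drift of order `θ`. -/
theorem signed_exp_abs_gaussian_le {θ : ℝ} (h0 : 0 ≤ θ) (h1 : θ ≤ 1) :
    (1 + θ) / 2 * ∫ x, Real.exp (-(θ / 6) * |x|) ∂(gaussianReal 0 1)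
      + (1 - θ) / 2 * ∫ x, Real.exp (θ / 6 * |x|) ∂(gaussianReal 0 1)
      ≤ Real.exp (-(θ ^ 2 / 36)) := by
  -- The left side is (Am + Ap)/2 - θ(Ap - Am)/2. The first term is at most 1 + θ²/36 and the second
  -- at least θμ/3 = θ²/18, leaving 1 - θ²/36.
  set μ := θ / 6 with hμ
  set Am := ∫ x, Real.exp (-μ * |x|) ∂(gaussianReal 0 1)
  set Ap := ∫ x, Real.exp (μ * |x|) ∂(gaussianReal 0 1)
  have hsum : Am + Ap = 2 * Real.exp (μ ^ 2 / 2) := by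
    have hm (t : ℝ) : ∫ x, Real.exp (t * x) ∂(gaussianReal 0 1) = Real.exp (t ^ 2 / 2) := by
      have := congrFun (mgf_fun_id_gaussianReal (μ := 0) (v := 1)) t
      simpa [mgf] using this
    rw [← integral_add (integrable_exp_mul_abs_gaussian _) (integrable_exp_mul_abs_gaussian _)]
    have : ∀ x : ℝ, Real.exp (-μ * |x|) + Real.exp (μ * |x|)
        = Real.exp (-μ * x) + Real.exp (μ * x) := by
      intro x
      rcases abs_cases x with ⟨h, _⟩ | ⟨h, _⟩ <;> rw [h]
      simp [add_comm]
    simp_rw [this]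
    rw [integral_add (integrable_exp_mul_gaussianReal _) (integrable_exp_mul_gaussianReal _),
      hm, hm]
    ring_nf
  have hdiff : 2 * μ / 3 ≤ Ap - Am := by
    rw [← integral_sub (integrable_exp_mul_abs_gaussian _) (integrable_exp_mul_abs_gaussian _)]
    have hint : Integrable (fun x : ℝ => x) (gaussianReal 0 1) :=
      (memLp_id_gaussianReal 1).integrable (by simp)
    calc 2 * μ / 3 ≤ 2 * μ * ∫ x, |x| ∂(gaussianReal 0 1) := by
          have := one_third_le_integral_abs_gaussian
          have : 0 ≤ μ := by positivity
          nlinarith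
      _ = ∫ x, 2 * μ * |x| ∂(gaussianReal 0 1) := by rw [integral_const_mul]
      _ ≤ _ := by
          refine integral_mono (hint.abs.const_mul _)
            ((integrable_exp_mul_abs_gaussian _).sub (integrable_exp_mul_abs_gaussian _))
            fun x => ?_
          -- The integrand is 2 sinh(μ|x|) ≥ 2μ|x|.
          have := Real.self_le_sinh_iff.2 (show 0 ≤ μ * |x| by positivity)
          rw [Real.sinh_eq] at this
          simp only [neg_mul]
          linarith
  have he : Real.exp (μ ^ 2 / 2) ≤ 1 + θ ^ 2 / 36 := by
    have hsq : θ ^ 2 ≤ 1 := by nlinarith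
    have hy : |θ ^ 2 / 72| ≤ 1 := by rw [abs_of_nonneg (by positivity)]; linarith
    have := Real.abs_exp_sub_one_le hy
    rw [abs_of_nonneg (show 0 ≤ θ ^ 2 / 72 by positivity)] at this
    have e : μ ^ 2 / 2 = θ ^ 2 / 72 := by rw [hμ]; ring
    rw [e]
    linarith [abs_le.1 this]
  have hexp := Real.add_one_le_exp (-(θ ^ 2 / 36))
  have : θ * (2 * μ / 3) ≤ θ * (Ap - Am) := mul_le_mul_of_nonneg_left hdiff h0
  rw [hμ] at this
  nlinarith

/-- The integral is again Gaussian and equals √2. -/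
theorem lintegral_exp_sq_gaussian_le :
    ∫⁻ x, ENNReal.ofReal (Real.exp (x ^ 2 / 4)) ∂(gaussianReal 0 1) ≤ 2 := by
  rw [gaussianReal_of_var_ne_zero _ one_ne_zero,
    lintegral_withDensity_eq_lintegral_mul _ (measurable_gaussianPDF _ _) (by fun_prop)]
  have e : ∀ x : ℝ, (gaussianPDF 0 1 * fun x => ENNReal.ofReal (Real.exp (x ^ 2 / 4))) x
      = ENNReal.ofReal ((√(2 * Real.pi))⁻¹ * Real.exp (-(1 / 4) * x ^ 2)) := by
    intro x
    rw [Pi.mul_apply, gaussianPDF, ← ENNReal.ofReal_mul (gaussianPDFReal_nonneg _ _ _),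
      gaussianPDFReal, mul_assoc, ← Real.exp_add]
    simp only [NNReal.coe_one, mul_one, sub_zero]
    congr 3
    ring
  simp_rw [e]
  rw [← ofReal_integral_eq_lintegral_ofReal
    ((integrable_exp_neg_mul_sq (by norm_num)).const_mul _) (.of_forall fun _ => by positivity),
    integral_const_mul, integral_gaussian, ← Real.sqrt_inv, ← Real.sqrt_mul (by positivity)]
  rw [show (2 * Real.pi)⁻¹ * (Real.pi / (1 / 4)) = 2 by field_simp; norm_num]
  rw [show (2 : ℝ≥0∞) = ENNReal.ofReal 2 by simp]
  refine ENNReal.ofReal_le_ofReal ?_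
  rw [Real.sqrt_le_left (by norm_num)]
  norm_num

theorem charFun_map_inner {Ω : Type*} [MeasurableSpace Ω] {P : Measure Ω} {m : ℕ} {γ : ℝ}
    {U : Ω → EuclideanSpace ℝ (Fin m)}
    (h : HasLaw U (multivariateGaussian 0 (γ ^ 2 • (1 : Matrix (Fin m) (Fin m) ℝ))) P)
    (v : EuclideanSpace ℝ (Fin m)) (x : ℝ) :
    charFun (P.map fun ω => inner ℝ v (U ω)) x
      = Complex.exp (-((γ ^ 2 * ‖v‖ ^ 2 * x ^ 2 / 2 : ℝ) : ℂ)) := by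
  have hps : (γ ^ 2 • (1 : Matrix (Fin m) (Fin m) ℝ)).PosSemidef :=
    Matrix.PosSemidef.one.smul (sq_nonneg γ)
  have e : charFun (P.map fun ω => inner ℝ v (U ω)) x = charFun (P.map U) (x • v) := by
    rw [charFun_apply, charFun_apply, integral_map h.aemeasurable (by fun_prop),
      integral_map (by have := h.aemeasurable; fun_prop) (by fun_prop)]
    simp [inner_smul_right, real_inner_comm]
  rw [e, h.map_eq, charFun_multivariateGaussian hps]
  congr 1
  have hv : ‖v‖ ^ 2 = v.ofLp ⬝ᵥ v.ofLp := by
    rw [EuclideanSpace.norm_sq_eq]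
    simp [dotProduct, pow_two]
  rw [hv]
  simp [Matrix.smul_mulVec, dotProduct_smul, smul_dotProduct]
  ring

theorem map_stackedInput_eq_gaussian {Ω : Type*} [MeasurableSpace Ω] {P : Measure Ω}
    {k m : ℕ} {γ : ℝ} {u : ℕ → Ω → EuclideanSpace ℝ (Fin m)} (hu : ∀ t, Measurable (u t))
    (hind : iIndepFun u P)
    (hlaw : ∀ t, HasLaw (u t) (multivariateGaussian 0 (γ ^ 2 • (1 : Matrix (Fin m) (Fin m) ℝ))) P)
    {t : ℕ} (ht : 2 * k - 1 ≤ t) (Δ : Fin (2 * k) × Fin m → ℝ)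
    (hΔ : γ ^ 2 * ∑ c, Δ c ^ 2 = 1) :
    P.map (fun ω => ∑ c, Δ c * stackedInput k (fun s => u s ω) t c) = gaussianReal 0 1 := by
  have : IsProbabilityMeasure P := hind.isProbabilityMeasure
  let v (j : Fin (2 * k)) : EuclideanSpace ℝ (Fin m) := WithLp.toLp 2 fun l => Δ (j, l)
  have hsum : (fun ω => ∑ c, Δ c * stackedInput k (fun s => u s ω) t c)
      = fun ω => ∑ j : Fin (2 * k), inner ℝ (v j) (u (t - j) ω) := by
    funext ω
    rw [Fintype.sum_prod_type]
    refine Finset.sum_congr rfl fun j _ => ?_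
    rw [PiLp.inner_apply]
    refine Finset.sum_congr rfl fun l _ => ?_
    simp [v, stackedInput, mul_comm]
  -- Truncated subtraction is injective here because `2 * k - 1 ≤ t`; hence the blocks of one
  -- stacked input are independent.
  have hinj : Function.Injective fun j : Fin (2 * k) => t - (j : ℕ) := by
    intro i j hij
    have := i.2
    have := j.2
    simp only at hij
    ext
    omega
  have hind2 : iIndepFun (fun (j : Fin (2 * k)) ω => inner ℝ (v j) (u (t - j) ω)) P :=
    (hind.precomp hinj).comp (fun j z => inner ℝ (v j) z) (fun j => by fun_prop)
  have hmeas (j : Fin (2 * k)) : Measurable fun ω => inner ℝ (v j) (u (t - j) ω) :=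
    (hu _).const_inner
  rw [hsum]
  have : IsProbabilityMeasure
      (P.map fun ω => ∑ j : Fin (2 * k), inner ℝ (v j) (u (t - j) ω)) :=
    Measure.isProbabilityMeasure_map (by fun_prop)
  refine Measure.ext_of_charFun ?_
  rw [hind2.charFun_map_fun_sum_eq_prod (fun j => (hmeas j).aemeasurable)]
  funext x
  rw [Finset.prod_apply, charFun_gaussianReal]
  simp_rw [charFun_map_inner (hlaw _)]
  rw [← Complex.exp_sum]
  congr 1
  have hv (j) : ‖v j‖ ^ 2 = ∑ l, Δ (j, l) ^ 2 := by
    rw [EuclideanSpace.norm_sq_eq]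
    simp [v]
  have hx : ∑ j, (γ ^ 2 * ‖v j‖ ^ 2 * x ^ 2 / 2) = x ^ 2 / 2 := by
    rw [← Finset.sum_div, ← Finset.sum_mul, ← Finset.mul_sum]
    simp_rw [hv]
    rw [Fintype.sum_prod_type] at hΔ
    rw [hΔ, one_mul]
  rw [Finset.sum_neg_distrib, ← Complex.ofReal_sum, hx]
  simp

/-! ### Signed sums in a fixed direction -/

/-- The sign of time `t`: `1` if no attack occurs at the times `t-2k+1, …, t-1`, and `-1`
otherwise. -/
noncomputable def attackSign (k : ℕ) (z : ℕ → Bool) (t : ℕ) : ℝ :=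
  if ∀ s ∈ Finset.Ico (t - (2 * k - 1)) t, z s = false then 1 else -1

theorem abs_attackSign (k : ℕ) (z : ℕ → Bool) (t : ℕ) : |attackSign k z t| = 1 := by
  unfold attackSign; split_ifs <;> simp

theorem measurable_attackSign (k t : ℕ) : Measurable fun z : ℕ → Bool => attackSign k z t := by
  refine Measurable.ite ?_ measurable_const measurable_const
  have : {z : ℕ → Bool | ∀ s ∈ Finset.Ico (t - (2 * k - 1)) t, z s = false}
      = ⋂ s ∈ Finset.Ico (t - (2 * k - 1)) t, (fun z : ℕ → Bool => z s) ⁻¹' {false} := by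
    ext z; simp
  rw [this]
  exact Finset.measurableSet_biInter _ fun s _ => measurable_pi_apply s (measurableSet_singleton _)

/-- For `2 * k - 1 ≤ t` the window is not truncated at 0 and has exactly 2k-1 times, all of which
must be attack-free for the sign to be 1. -/
theorem lintegral_attackSign {Ω : Type*} [MeasurableSpace Ω] {P : Measure Ω}
    {ξ : ℕ → Ω → Bool} (hξ : ∀ t, Measurable (ξ t)) (hind : iIndepFun ξ P) {p : ℝ} (hp0 : 0 ≤ p)
    (hp1 : p ≤ 1) (hp : ∀ t, P {ω | ξ t ω = true} = ENNReal.ofReal p) {k t : ℕ}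
    (ht : 2 * k - 1 ≤ t) (ψ : ℝ → ℝ≥0∞) :
    ∫⁻ ω, ψ (attackSign k (fun s => ξ s ω) t) ∂P
      = ENNReal.ofReal ((1 - p) ^ (2 * k - 1)) * ψ 1
        + ENNReal.ofReal (1 - (1 - p) ^ (2 * k - 1)) * ψ (-1) := by
  have : IsProbabilityMeasure P := hind.isProbabilityMeasure
  let C := {ω | ∀ s ∈ Finset.Ico (t - (2 * k - 1)) t, ξ s ω = false}
  have hCeq : C = ⋂ s ∈ Finset.Ico (t - (2 * k - 1)) t, ξ s ⁻¹' {false} := by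
    ext ω; simp [C]
  have hCm : MeasurableSet C := by
    rw [hCeq]
    exact Finset.measurableSet_biInter _ fun s _ => hξ s (measurableSet_singleton _)
  have hfalse (s : ℕ) : P (ξ s ⁻¹' {false}) = ENNReal.ofReal (1 - p) := by
    have e : ξ s ⁻¹' {false} = {ω | ξ s ω = true}ᶜ := by ext ω; simp
    rw [e, measure_compl (show MeasurableSet {ω | ξ s ω = true} from hξ s (measurableSet_singleton true))
      (measure_ne_top _ _), hp,
      measure_univ, ENNReal.ofReal_sub _ hp0, ENNReal.ofReal_one]
  have hPC : P C = ENNReal.ofReal ((1 - p) ^ (2 * k - 1)) := by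
    rw [hCeq, hind.measure_inter_preimage_eq_mul _ (fun _ _ => measurableSet_singleton _)]
    simp_rw [hfalse]
    rw [Finset.prod_const, Nat.card_Ico, ENNReal.ofReal_pow (by linarith)]
    congr 1
    omega
  have hPCc : P Cᶜ = ENNReal.ofReal (1 - (1 - p) ^ (2 * k - 1)) := by
    rw [measure_compl hCm (measure_ne_top _ _), hPC, measure_univ,
      ENNReal.ofReal_sub _ (by have : 0 ≤ 1 - p := by linarith
                               positivity), ENNReal.ofReal_one]
  rw [← lintegral_add_compl _ hCm, setLIntegral_congr_fun (g := fun _ => ψ 1) hCm,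
    setLIntegral_congr_fun (s := Cᶜ) (g := fun _ => ψ (-1)) hCm.compl]
  · simp [hPC, hPCc, mul_comm]
  · intro ω hω
    have : ¬ ∀ s ∈ Finset.Ico (t - (2 * k - 1)) t, ξ s ω = false := hω
    simp only [attackSign, if_neg this]
  · intro ω hω
    have : ∀ s ∈ Finset.Ico (t - (2 * k - 1)) t, ξ s ω = false := hω
    simp only [attackSign, if_pos this]

theorem measurable_stackedInput {m k : ℕ} (t : ℕ) (Δ : Fin (2 * k) × Fin m → ℝ) :
    Measurable fun z : ℕ → EuclideanSpace ℝ (Fin m) => ∑ c, Δ c * stackedInput k z t c := by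
  unfold stackedInput
  fun_prop

/-- The exponential moment of the signed sum over well-separated times. -/
theorem lintegral_prod_signed_exp_le {Ω : Type*} [MeasurableSpace Ω] {P : Measure Ω}
    {k m : ℕ} {γ p θ : ℝ}
    {u : ℕ → Ω → EuclideanSpace ℝ (Fin m)} (hu : ∀ t, Measurable (u t)) (huind : iIndepFun u P)
    (hlaw : ∀ t, HasLaw (u t) (multivariateGaussian 0 (γ ^ 2 • (1 : Matrix (Fin m) (Fin m) ℝ))) P)
    {ξ : ℕ → Ω → Bool} (hξ : ∀ t, Measurable (ξ t)) (hξind : iIndepFun ξ P) (hp0 : 0 ≤ p)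
    (hp1 : p ≤ 1) (hp : ∀ t, P {ω | ξ t ω = true} = ENNReal.ofReal p)
    (huξ : IndepFun (fun ω t => u t ω) (fun ω t => ξ t ω) P)
    (hθ : (1 + θ) / 2 = (1 - p) ^ (2 * k - 1)) (hθ0 : 0 ≤ θ) (hθ1 : θ ≤ 1)
    (Δ : Fin (2 * k) × Fin m → ℝ) (hΔ : γ ^ 2 * ∑ c, Δ c ^ 2 = 1)
    (I : Finset ℕ) (hI : ∀ t ∈ I, 2 * k - 1 ≤ t)
    (hsep : ∀ t ∈ I, ∀ t' ∈ I, t < t' → t + 2 * k ≤ t') :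
    ∫⁻ ω, ENNReal.ofReal (Real.exp (∑ t ∈ I, -(θ / 6) * (attackSign k (fun s => ξ s ω) t
        * |∑ c, Δ c * stackedInput k (fun s => u s ω) t c|))) ∂P
      ≤ ENNReal.ofReal (Real.exp (-(θ ^ 2 / 36) * I.card)) := by
  have : IsProbabilityMeasure P := huind.isProbabilityMeasure
  let F (σ : ℕ → ℝ) (t : ℕ) (z : ℕ → EuclideanSpace ℝ (Fin m)) : ℝ≥0∞ :=
    ENNReal.ofReal (Real.exp (-(θ / 6) * (σ t * |∑ c, Δ c * stackedInput k z t c|)))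
  -- The factor of one time with its sign frozen: the inputs are integrated out first, for fixed
  -- signs, and the signs afterwards.
  let ψ (σ : ℝ) : ℝ≥0∞ :=
    ENNReal.ofReal (∫ x, Real.exp (-(θ / 6) * σ * |x|) ∂(gaussianReal 0 1))
  -- The same disjoint blocks serve twice, for the inputs and for the attack indicators.
  have hdisj : ∀ i ∈ I, ∀ j ∈ I, i ≠ j →
      Disjoint (Finset.Icc (i - (2 * k - 1)) i) (Finset.Icc (j - (2 * k - 1)) j) := by
    intro i hi j hj hij
    rw [Finset.disjoint_left]
    intro s hs hs'
    rw [Finset.mem_Icc] at hs hs'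
    have := hI i hi
    have := hI j hj
    rcases lt_or_gt_of_ne hij with h | h
    · have := hsep i hi j hj h; omega
    · have := hsep j hj i hi h; omega
  have hFm (σ : ℕ → ℝ) (t : ℕ) : Measurable (F σ t) :=
    ENNReal.measurable_ofReal.comp (Real.measurable_exp.comp
      (((measurable_stackedInput t Δ).abs.const_mul _).const_mul _))
  have hFint (σ : ℕ → ℝ) (t : ℕ) (ht : t ∈ I) :
      ∫⁻ ω, F σ t (fun s => u s ω) ∂P = ψ (σ t) := by
    have hg := map_stackedInput_eq_gaussian hu huind hlaw (hI t ht) Δ hΔ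
    have hm : Measurable fun ω => ∑ c, Δ c * stackedInput k (fun s => u s ω) t c :=
      (measurable_stackedInput t Δ).comp (measurable_pi_lambda _ hu)
    simp only [ψ]
    rw [ofReal_integral_eq_lintegral_ofReal (integrable_exp_mul_abs_gaussian _)
      (.of_forall fun _ => (Real.exp_pos _).le), ← hg, lintegral_map (by fun_prop) hm]
    simp only [F, mul_assoc]
  have hinner (σ : ℕ → ℝ) : ∫⁻ ω, ∏ t ∈ I, F σ t (fun s => u s ω) ∂P = ∏ t ∈ I, ψ (σ t) := by
    rw [lintegral_prod_of_disjoint_blocks hu huind I (fun t => Finset.Icc (t - (2 * k - 1)) t)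
      hdisj (F σ) (hFm σ)]
    · exact Finset.prod_congr rfl fun t ht => hFint σ t ht
    · intro t ht z z' hz
      simp only [F, stackedInput]
      congr 6
      funext c
      have hc := c.1.2
      have := hI t ht
      rw [hz (t - c.1) (by rw [Finset.mem_Icc]; omega)]
  have hψ : Measurable ψ := by
    refine ENNReal.measurable_ofReal.comp ?_
    refine StronglyMeasurable.measurable ?_
    exact StronglyMeasurable.integral_prod_right'
      (f := fun z : ℝ × ℝ => Real.exp (-(θ / 6) * z.1 * |z.2|)) (by
        refine Measurable.stronglyMeasurable ?_
        fun_prop)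
  have hexp : ∀ ω, ENNReal.ofReal (Real.exp (∑ t ∈ I, -(θ / 6) * (attackSign k (fun s => ξ s ω) t
        * |∑ c, Δ c * stackedInput k (fun s => u s ω) t c|)))
      = ∏ t ∈ I, F (attackSign k fun s => ξ s ω) t (fun s => u s ω) := by
    intro ω
    rw [Real.exp_sum, ENNReal.ofReal_prod_of_nonneg fun _ _ => (Real.exp_pos _).le]
  simp_rw [hexp]
  rw [lintegral_comp_of_indepFun (X := fun ω t => u t ω) (Y := fun ω t => ξ t ω)
    (F := fun x y => ∏ t ∈ I, F (attackSign k y) t x) (measurable_pi_lambda _ hu)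
    (measurable_pi_lambda _ hξ) huξ ?_]
  · simp_rw [hinner]
    rw [lintegral_prod_of_disjoint_blocks hξ hξind I (fun t => Finset.Icc (t - (2 * k - 1)) t)
      hdisj (fun t z => ψ (attackSign k z t)) (fun t => hψ.comp (measurable_attackSign k t))]
    · rw [mul_comm, Real.exp_nat_mul, ENNReal.ofReal_pow (Real.exp_pos _).le,
        ← Finset.prod_const]
      refine Finset.prod_le_prod' fun t ht => ?_
      rw [lintegral_attackSign hξ hξind hp0 hp1 hp (hI t ht) ψ, ← hθ]
      have hi : ∀ σ : ℝ, 0 ≤ ∫ x, Real.exp (-(θ / 6) * σ * |x|) ∂(gaussianReal 0 1) :=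
        fun σ => integral_nonneg fun x => (Real.exp_pos _).le
      simp only [ψ]
      rw [← ENNReal.ofReal_mul (by linarith), ← ENNReal.ofReal_mul (by linarith),
        ← ENNReal.ofReal_add (mul_nonneg (by linarith) (hi _)) (mul_nonneg (by linarith) (hi _))]
      refine ENNReal.ofReal_le_ofReal ?_
      have := signed_exp_abs_gaussian_le hθ0 hθ1
      rw [show 1 - (1 + θ) / 2 = (1 - θ) / 2 by ring]
      simpa using this
    · intro t ht z z' hz
      simp only [attackSign]
      congr 2
      refine propext (forall₂_congr fun s hs => ?_)
      rw [Finset.mem_Ico] at hs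
      rw [hz s (by rw [Finset.mem_Icc]; omega)]
  · refine Finset.measurable_prod _ fun t _ => ENNReal.measurable_ofReal.comp
      (Real.measurable_exp.comp (Measurable.const_mul (Measurable.mul ?_ ?_) _))
    · exact (measurable_attackSign k t).comp measurable_snd
    · exact ((measurable_stackedInput t Δ).comp measurable_fst).abs

/-- Over the observation times, t + 1 starts at the multiple 2k; the times with t + 1 = 2k(a+1) + j
and a < T/(2k) all lie in the range. -/
theorem le_card_residue_class {k T j : ℕ} (hj : j < 2 * k) :
    T / (2 * k) ≤ (Finset.filter (fun t => (t + 1) % (2 * k) = j)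
      (Finset.Icc (2 * k - 1) (T + 2 * k - 2))).card := by
  have hinj : Set.InjOn (fun a => 2 * k * (a + 1) + j - 1) (Finset.range (T / (2 * k)) : Set ℕ) := by
    intro a _ b _ hab
    simp only at hab
    have h1 : 2 * k * (a + 1) ≥ 1 := by nlinarith
    have h2 : 2 * k * (b + 1) ≥ 1 := by nlinarith
    have h3 : 2 * k * (a + 1) = 2 * k * (b + 1) := by omega
    have := Nat.eq_of_mul_eq_mul_left (by omega) h3
    omega
  rw [← Finset.card_range (T / (2 * k)), ← Finset.card_image_of_injOn hinj]
  refine Finset.card_le_card fun t ht => ?_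
  obtain ⟨a, ha, rfl⟩ := Finset.mem_image.1 ht
  rw [Finset.mem_range] at ha
  have h1 : 2 * k * (a + 1) ≤ T := by
    calc 2 * k * (a + 1) ≤ 2 * k * (T / (2 * k)) := Nat.mul_le_mul_left _ ha
      _ ≤ T := Nat.mul_div_le T (2 * k)
  have h2 : 2 * k ≤ 2 * k * (a + 1) := by nlinarith
  rw [Finset.mem_filter, Finset.mem_Icc]
  refine ⟨by omega, ?_⟩
  rw [show 2 * k * (a + 1) + j - 1 + 1 = j + 2 * k * (a + 1) by omega,
    Nat.add_mul_mod_self_left, Nat.mod_eq_of_lt hj]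

/-- Concentration of the signed sum of absolute values for one fixed direction. -/
theorem measure_signed_sum_lt_le {Ω : Type*} [MeasurableSpace Ω] {P : Measure Ω}
    {k m T : ℕ} {γ p θ : ℝ} (hk : 1 ≤ k) (hT : 4 * k ≤ T)
    {u : ℕ → Ω → EuclideanSpace ℝ (Fin m)} (hu : ∀ t, Measurable (u t)) (huind : iIndepFun u P)
    (hlaw : ∀ t, HasLaw (u t) (multivariateGaussian 0 (γ ^ 2 • (1 : Matrix (Fin m) (Fin m) ℝ))) P)
    {ξ : ℕ → Ω → Bool} (hξ : ∀ t, Measurable (ξ t)) (hξind : iIndepFun ξ P) (hp0 : 0 ≤ p)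
    (hp1 : p ≤ 1) (hp : ∀ t, P {ω | ξ t ω = true} = ENNReal.ofReal p)
    (huξ : IndepFun (fun ω t => u t ω) (fun ω t => ξ t ω) P)
    (hθ : (1 + θ) / 2 = (1 - p) ^ (2 * k - 1)) (hθ0 : 0 < θ) (hθ1 : θ ≤ 1)
    (Δ : Fin (2 * k) × Fin m → ℝ) (hΔ : γ ^ 2 * ∑ c, Δ c ^ 2 = 1) :
    P {ω | ∑ t ∈ Finset.Icc (2 * k - 1) (T + 2 * k - 2), attackSign k (fun s => ξ s ω) t
        * |∑ c, Δ c * stackedInput k (fun s => u s ω) t c| < θ * T / 24}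
      ≤ ENNReal.ofReal (Real.exp (-(θ ^ 2 * T / (288 * k)))) := by
  have : IsProbabilityMeasure P := huind.isProbabilityMeasure
  have hk' : (0 : ℝ) < k := by exact_mod_cast hk
  let J := Finset.Icc (2 * k - 1) (T + 2 * k - 2)
  let I (j : ℕ) := Finset.filter (fun t => (t + 1) % (2 * k) = j) J
  let g (t : ℕ) (ω : Ω) : ℝ := attackSign k (fun s => ξ s ω) t
        * |∑ c, Δ c * stackedInput k (fun s => u s ω) t c|
  have hg (t : ℕ) : Measurable (g t) :=
    ((measurable_attackSign k t).comp (measurable_pi_lambda _ hξ)).mul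
      ((measurable_stackedInput t Δ).comp (measurable_pi_lambda _ hu)).abs
  -- This is θ²/36 times T/(4k). Each residue class has at least ⌊T/(2k)⌋ ≥ T/(4k) times as T ≥ 4k,
  -- so adding `b` keeps its exponential moment at most 1.
  let b : ℝ := θ ^ 2 * T / (144 * k)
  let Y (j : ℕ) (ω : Ω) : ℝ := b + ∑ t ∈ I j, -(θ / 6) * g t ω
  have hY (j : ℕ) : Measurable (Y j) := by fun_prop
  have hYint : ∀ j ∈ Finset.range (2 * k),
      ∫⁻ ω, ENNReal.ofReal (Real.exp (Y j ω)) ∂P ≤ 1 := by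
    intro j hj
    have hmain := lintegral_prod_signed_exp_le hu huind hlaw hξ hξind hp0 hp1 hp huξ hθ hθ0.le hθ1
      Δ hΔ (I j) (fun t ht => (Finset.mem_Icc.1 (Finset.mem_filter.1 ht).1).1) (by
        intro t ht t' ht' htt
        have h1 := (Finset.mem_filter.1 ht).2
        have h2 := (Finset.mem_filter.1 ht').2
        have h3 : (t + 1) ≡ (t' + 1) [MOD 2 * k] := h1.trans h2.symm
        have h4 := (Nat.modEq_iff_dvd' (by omega)).1 h3
        have := Nat.le_of_dvd (by omega) h4
        omega)
    have hcard : (T : ℝ) / (4 * k) ≤ (I j).card := by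
      have h1 : ((T / (2 * k) : ℕ) : ℝ) ≤ (I j).card := by
        exact_mod_cast le_card_residue_class (Finset.mem_range.1 hj)
      refine le_trans ?_ h1
      have h2 : T < 2 * k * (T / (2 * k) + 1) := Nat.lt_mul_div_succ T (by omega)
      have h3 : (T : ℝ) < 2 * k * (((T / (2 * k) : ℕ) : ℝ) + 1) := by exact_mod_cast h2
      have h4 : (4 : ℝ) * k ≤ T := by exact_mod_cast hT
      rw [div_le_iff₀ (by positivity)]
      nlinarith
    simp only [Y, Real.exp_add]
    simp_rw [ENNReal.ofReal_mul (Real.exp_pos _).le]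
    rw [lintegral_const_mul _ (by fun_prop)]
    calc _ ≤ ENNReal.ofReal (Real.exp b) *
          ENNReal.ofReal (Real.exp (-(θ ^ 2 / 36) * (I j).card)) := by gcongr
      _ = ENNReal.ofReal (Real.exp (b + -(θ ^ 2 / 36) * (I j).card)) := by
          rw [← ENNReal.ofReal_mul (Real.exp_pos _).le, Real.exp_add]
      _ ≤ 1 := by
          rw [ENNReal.ofReal_le_one, Real.exp_le_one_iff]
          have : b = θ ^ 2 / 36 * (T / (4 * k)) := by simp only [b]; field_simp; ring
          rw [this]
          nlinarith [sq_nonneg θ]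
  -- The 2k classes depend on each other, so they are averaged with equal weights rather than
  -- multiplied.
  have hcomb := lintegral_exp_sum_le (P := P) (Finset.range (2 * k)) (fun _ => 1 / (2 * (k : ℝ)))
    (fun _ _ => by positivity) (by simp; field_simp; norm_num) Y hY le_rfl hYint
  have hsum (ω : Ω) : ∑ j ∈ Finset.range (2 * k), 1 / (2 * (k : ℝ)) * Y j ω
      = b - θ / (12 * k) * ∑ t ∈ J, g t ω := by
    have h1 : ∑ j ∈ Finset.range (2 * k), ∑ t ∈ I j, g t ω = ∑ t ∈ J, g t ω :=
      Finset.sum_fiberwise_of_maps_to (fun t _ => Finset.mem_range.2 (Nat.mod_lt _ (by omega))) _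
    rw [← h1, ← Finset.mul_sum]
    simp only [Y]
    rw [Finset.sum_add_distrib]
    simp only [← Finset.mul_sum]
    simp
    field_simp
    ring
  simp_rw [hsum] at hcomb
  have hcher := measure_gt_le_of_exp_moment (P := P)
    (Y := fun ω => b - θ / (12 * k) * ∑ t ∈ J, g t ω) (by fun_prop) (b := 0)
    (s := θ ^ 2 * T / (288 * k)) (ε := Real.exp (-(θ ^ 2 * T / (288 * k)))) (by simpa using hcomb)
    (by simp)
  refine le_trans (measure_mono fun ω hω => ?_) hcher
  have hω' : ∑ t ∈ J, g t ω < θ * T / 24 := hω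
  have h1 : θ / (12 * k) * ∑ t ∈ J, g t ω < θ / (12 * k) * (θ * T / 24) :=
    mul_lt_mul_of_pos_left hω' (by positivity)
  -- The threshold θT/24 uses up exactly half of `b`; the other half is the exponent in the tail
  -- bound.
  have h2 : b - θ / (12 * k) * (θ * T / 24) = θ ^ 2 * T / (288 * k) := by
    simp only [b]; field_simp; ring
  simp only [Set.mem_ofPred_eq]
  linarith

/-! ### Uniformity over directions -/

/-- The stacked input as a vector of Euclidean space. -/
noncomputable def stackedVec {m : ℕ} (k : ℕ) (u : ℕ → EuclideanSpace ℝ (Fin m)) (t : ℕ) :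
    EuclideanSpace ℝ (Fin (2 * k) × Fin m) := WithLp.toLp 2 (stackedInput k u t)

theorem inner_stackedVec {m k : ℕ} (v : EuclideanSpace ℝ (Fin (2 * k) × Fin m))
    (u : ℕ → EuclideanSpace ℝ (Fin m)) (t : ℕ) :
    inner ℝ v (stackedVec k u t) = ∑ c, v c * stackedInput k u t c := by
  rw [PiLp.inner_apply]
  exact Finset.sum_congr rfl fun c _ => by simp [stackedVec, mul_comm]

/-- Simultaneous concentration over all integer vectors with entries of size at most `N`. -/
theorem measure_exists_signed_sum_lt_le {Ω : Type*} [MeasurableSpace Ω] {P : Measure Ω}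
    {k m T : ℕ} {γ p θ : ℝ} (hk : 1 ≤ k) (hT : 4 * k ≤ T) (hγ : 0 < γ)
    {u : ℕ → Ω → EuclideanSpace ℝ (Fin m)} (hu : ∀ t, Measurable (u t)) (huind : iIndepFun u P)
    (hlaw : ∀ t, HasLaw (u t) (multivariateGaussian 0 (γ ^ 2 • (1 : Matrix (Fin m) (Fin m) ℝ))) P)
    {ξ : ℕ → Ω → Bool} (hξ : ∀ t, Measurable (ξ t)) (hξind : iIndepFun ξ P) (hp0 : 0 ≤ p)
    (hp1 : p ≤ 1) (hp : ∀ t, P {ω | ξ t ω = true} = ENNReal.ofReal p)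
    (huξ : IndepFun (fun ω t => u t ω) (fun ω t => ξ t ω) P)
    (hθ : (1 + θ) / 2 = (1 - p) ^ (2 * k - 1)) (hθ0 : 0 < θ) (hθ1 : θ ≤ 1) (N : ℕ) :
    P {ω | ∃ v : EuclideanSpace ℝ (Fin (2 * k) × Fin m),
        (∃ z : Fin (2 * k) × Fin m → ℤ, (∀ c, |z c| ≤ N) ∧ ∀ c, v c = z c) ∧
        ∑ t ∈ Finset.Icc (2 * k - 1) (T + 2 * k - 2), attackSign k (fun s => ξ s ω) t
          * |inner ℝ v (stackedVec k (fun s => u s ω) t)| < θ * γ * T / 24 * ‖v‖}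
      ≤ ENNReal.ofReal ((2 * N + 1) ^ (2 * k * m) * Real.exp (-(θ ^ 2 * T / (288 * k)))) := by
  classical
  let S := Fintype.piFinset fun _ : Fin (2 * k) × Fin m => Finset.Icc (-(N : ℤ)) N
  let V (z : Fin (2 * k) × Fin m → ℤ) : EuclideanSpace ℝ (Fin (2 * k) × Fin m) :=
    WithLp.toLp 2 fun c => (z c : ℝ)
  let bad (v : EuclideanSpace ℝ (Fin (2 * k) × Fin m)) : Set Ω :=
    {ω | ∑ t ∈ Finset.Icc (2 * k - 1) (T + 2 * k - 2), attackSign k (fun s => ξ s ω) t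
          * |inner ℝ v (stackedVec k (fun s => u s ω) t)| < θ * γ * T / 24 * ‖v‖}
  have hbad (v) : P (bad v) ≤ ENNReal.ofReal (Real.exp (-(θ ^ 2 * T / (288 * k)))) := by
    rcases eq_or_ne v 0 with rfl | hv
    · simp [bad]
    have hv' : 0 < ‖v‖ := norm_pos_iff.2 hv
    -- The event is homogeneous in `v`, which is rescaled so that its inner product with the stacked
    -- input is standard normal.
    refine le_trans (measure_mono ?_) (measure_signed_sum_lt_le hk hT hu huind hlaw hξ hξind hp0
      hp1 hp huξ hθ hθ0 hθ1 (fun c => (γ * ‖v‖)⁻¹ * v c) ?_)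
    · intro ω hω
      simp only [bad, Set.mem_ofPred_eq] at hω ⊢
      simp_rw [mul_assoc, ← Finset.mul_sum, ← inner_stackedVec, abs_mul]
      have : ∀ t, attackSign k (fun s => ξ s ω) t * (|(γ * ‖v‖)⁻¹|
          * |inner ℝ v (stackedVec k (fun s => u s ω) t)|) = (γ * ‖v‖)⁻¹ *
          (attackSign k (fun s => ξ s ω) t * |inner ℝ v (stackedVec k (fun s => u s ω) t)|) := by
        intro t
        rw [abs_of_pos (by positivity)]
        ring
      simp_rw [this]
      rw [← Finset.mul_sum, inv_mul_lt_iff₀ (by positivity)]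
      linarith
    · simp_rw [mul_pow]
      rw [← Finset.mul_sum]
      have : ∑ c, v c ^ 2 = ‖v‖ ^ 2 := by
        rw [EuclideanSpace.norm_sq_eq]
        simp
      rw [this]
      field_simp
  calc _ ≤ P (⋃ z ∈ S, bad (V z)) := by
        refine measure_mono ?_
        rintro ω ⟨v, ⟨z, hz, hvz⟩, hω⟩
        have hvV : v = V z := by ext c; exact hvz c
        refine Set.mem_iUnion₂.2 ⟨z, ?_, hvV ▸ hω⟩
        exact Fintype.mem_piFinset.2 fun c => Finset.mem_Icc.2 (abs_le.1 (hz c))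
    _ ≤ ∑ z ∈ S, P (bad (V z)) := measure_biUnion_finset_le _ _
    _ ≤ ∑ _z ∈ S, ENNReal.ofReal (Real.exp (-(θ ^ 2 * T / (288 * k)))) :=
        Finset.sum_le_sum fun z _ => hbad _
    _ = _ := by
        rw [Finset.sum_const, Fintype.card_piFinset, ENNReal.ofReal_mul (by positivity),
          nsmul_eq_mul]
        congr 1
        have e : (Finset.Icc (-(N : ℤ)) N).card = 2 * N + 1 := by
          rw [Int.card_Icc]; omega
        simp only [e, Finset.prod_const, Finset.card_univ, Fintype.card_prod, Fintype.card_fin]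
        rw [show ((2 * N + 1 : ℝ)) = ((2 * N + 1 : ℕ) : ℝ) by push_cast; ring,
          ← Nat.cast_pow, ENNReal.ofReal_natCast]

/-- A lower bound over integer vectors extends to all vectors by rounding. -/
theorem le_signed_sum_of_integer {ι : Type*} [Fintype ι] (J : Finset ℕ)
    (U : ℕ → EuclideanSpace ℝ ι) (σ : ℕ → ℝ) (hσ : ∀ t, |σ t| = 1) (N : ℕ) {c b : ℝ} (hc : 0 ≤ c)
    (h : ∀ v : EuclideanSpace ℝ ι, (∃ z : ι → ℤ, (∀ i, |z i| ≤ N) ∧ ∀ i, v i = z i) →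
      c * ‖v‖ ≤ ∑ t ∈ J, σ t * |inner ℝ v (U t)|)
    (hb : ∑ t ∈ J, ‖U t‖ ≤ b) (Δ : EuclideanSpace ℝ ι) :
    (c * (N - √(Fintype.card ι)) - √(Fintype.card ι) * b) * ‖Δ‖
      ≤ N * ∑ t ∈ J, σ t * |inner ℝ Δ (U t)| := by
  rcases eq_or_ne Δ 0 with rfl | hΔ
  · simp
  have hΔ' : 0 < ‖Δ‖ := norm_pos_iff.2 hΔ
  -- At length `N`, rounding each coordinate down moves the vector by at most the square root of the
  -- dimension, which is relatively small for large `N`.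
  let x : EuclideanSpace ℝ ι := ((N : ℝ) / ‖Δ‖) • Δ
  have hx (i : ι) : |x i| ≤ N := by
    have h1 : |Δ i| ≤ ‖Δ‖ := by simpa using PiLp.norm_apply_le Δ i
    have h2 : x i = (N : ℝ) / ‖Δ‖ * Δ i := rfl
    rw [h2, abs_mul, abs_of_nonneg (by positivity), div_mul_eq_mul_div, div_le_iff₀ hΔ']
    gcongr
  have hxn : ‖x‖ = N := by
    rw [norm_smul, Real.norm_of_nonneg (by positivity), div_mul_cancel₀ _ hΔ'.ne']
  let v : EuclideanSpace ℝ ι := WithLp.toLp 2 fun i => ((⌊x i⌋ : ℤ) : ℝ)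
  have hxv : ‖x - v‖ ≤ √(Fintype.card ι) := by
    rw [EuclideanSpace.norm_eq]
    refine Real.sqrt_le_sqrt ?_
    calc ∑ i, ‖(x - v) i‖ ^ 2 ≤ ∑ _i : ι, (1 : ℝ) := by
          refine Finset.sum_le_sum fun i _ => ?_
          have h1 : (x - v) i = x i - ⌊x i⌋ := rfl
          have h2 := Int.floor_le (x i)
          have h3 := Int.lt_floor_add_one (x i)
          rw [h1, Real.norm_eq_abs, sq_abs]
          nlinarith
      _ = _ := by simp
  have hv := h v ⟨fun i => ⌊x i⌋, fun i => by
    have := abs_le.1 (hx i)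
    rw [abs_le]
    refine ⟨Int.le_floor.2 (by push_cast; exact this.1), ?_⟩
    have h1 : ((⌊x i⌋ : ℤ) : ℝ) ≤ ((N : ℤ) : ℝ) := by
      push_cast
      exact (Int.floor_le (x i)).trans this.2
    exact Int.cast_le.1 h1, fun i => rfl⟩
  have hvn : N - √(Fintype.card ι) ≤ ‖v‖ := by
    have := norm_sub_norm_le x v
    rw [hxn] at this
    linarith
  have hterm (t : ℕ) : σ t * |inner ℝ v (U t)|
      ≤ σ t * |inner ℝ x (U t)| + √(Fintype.card ι) * ‖U t‖ := by
    have h1 : |(|inner ℝ x (U t)| - |inner ℝ v (U t)|)| ≤ √(Fintype.card ι) * ‖U t‖ := by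
      refine (abs_abs_sub_abs_le_abs_sub _ _).trans ?_
      rw [← inner_sub_left]
      refine (abs_real_inner_le_norm _ _).trans ?_
      gcongr
    have h2 : |σ t * (|inner ℝ x (U t)| - |inner ℝ v (U t)|)| ≤ √(Fintype.card ι) * ‖U t‖ := by
      rw [abs_mul, hσ, one_mul]; exact h1
    have := (abs_le.1 h2).1
    linarith
  have hsum := Finset.sum_le_sum fun t (_ : t ∈ J) => hterm t
  rw [Finset.sum_add_distrib, ← Finset.mul_sum] at hsum
  have hxs : ∑ t ∈ J, σ t * |inner ℝ x (U t)|
      = (N : ℝ) / ‖Δ‖ * ∑ t ∈ J, σ t * |inner ℝ Δ (U t)| := by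
    rw [Finset.mul_sum]
    refine Finset.sum_congr rfl fun t _ => ?_
    rw [real_inner_smul_left, abs_mul, abs_of_nonneg (by positivity)]
    ring
  rw [hxs] at hsum
  have h1 : c * (N - √(Fintype.card ι)) - √(Fintype.card ι) * b
      ≤ (N : ℝ) / ‖Δ‖ * ∑ t ∈ J, σ t * |inner ℝ Δ (U t)| := by
    have := mul_le_mul_of_nonneg_left hvn hc
    have := mul_le_mul_of_nonneg_left hb (Real.sqrt_nonneg (Fintype.card ι))
    linarith
  rw [div_mul_eq_mul_div, le_div_iff₀ hΔ'] at h1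
  exact h1

/-! ### Exponential moments of inputs and attacks -/

/-- Exponential moment of the total squared length of Gaussian inputs. -/
theorem lintegral_exp_sum_norm_sq_le {Ω : Type*} [MeasurableSpace Ω] {P : Measure Ω} {m : ℕ}
    (hm : 1 ≤ m) {γ : ℝ} (hγ : 0 < γ) {u : ℕ → Ω → EuclideanSpace ℝ (Fin m)}
    (hu : ∀ t, Measurable (u t)) (hind : iIndepFun u P)
    (hlaw : ∀ t, HasLaw (u t) (multivariateGaussian 0 (γ ^ 2 • (1 : Matrix (Fin m) (Fin m) ℝ))) P)
    (n : ℕ) :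
    ∫⁻ ω, ENNReal.ofReal (Real.exp ((4 * m * γ ^ 2)⁻¹ * ∑ s ∈ Finset.range n, ‖u s ω‖ ^ 2)) ∂P
      ≤ 2 ^ n := by
  have : IsProbabilityMeasure P := hind.isProbabilityMeasure
  have hm' : (0 : ℝ) < m := by exact_mod_cast hm
  have hcoord (l : Fin m) (s : ℕ) :
      ∫⁻ ω, ENNReal.ofReal (Real.exp ((u s ω l / γ) ^ 2 / 4)) ∂P ≤ 2 := by
    have hg : P.map (fun ω => u s ω l / γ) = gaussianReal 0 1 := by
      have hmeas : Measurable fun ω => u s ω l / γ := by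
        have := hu s; fun_prop
      have : IsProbabilityMeasure (P.map (fun ω => u s ω l / γ)) :=
        Measure.isProbabilityMeasure_map hmeas.aemeasurable
      refine Measure.ext_of_charFun (funext fun x => ?_)
      have e : (fun ω => u s ω l / γ) = fun ω => inner ℝ (EuclideanSpace.single l (γ⁻¹)) (u s ω) := by
        funext ω
        simp [EuclideanSpace.inner_single_left, div_eq_inv_mul]
      rw [e, charFun_map_inner (hlaw s), charFun_gaussianReal]
      congr 1
      rw [PiLp.norm_single, Real.norm_eq_abs, sq_abs, ← mul_pow,
        mul_inv_cancel₀ hγ.ne']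
      simp
    have hmeas : Measurable fun ω => u s ω l / γ := by
      have := hu s; fun_prop
    refine le_trans (le_of_eq ?_) lintegral_exp_sq_gaussian_le
    rw [← hg, lintegral_map (by fun_prop) hmeas]
  have hY (l : Fin m) : ∫⁻ ω, ENNReal.ofReal
      (Real.exp (∑ s ∈ Finset.range n, (u s ω l / γ) ^ 2 / 4)) ∂P ≤ 2 ^ n := by
    have hi := hind.comp (fun _ z => ENNReal.ofReal (Real.exp ((z l / γ) ^ 2 / 4)))
      (fun _ => by fun_prop)
    have := lintegral_prod_eq_prod_lintegral_of_indepFun (Finset.range n) _ hi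
      (fun s => by have := hu s; simp only [Function.comp_def]; fun_prop)
    simp only [Function.comp_apply] at this
    simp_rw [Real.exp_sum, ENNReal.ofReal_prod_of_nonneg fun _ _ => (Real.exp_pos _).le]
    rw [this]
    calc _ ≤ ∏ _s ∈ Finset.range n, (2 : ℝ≥0∞) := Finset.prod_le_prod' fun s _ => hcoord l s
      _ = _ := by simp
  -- Averaging over the m coordinates gives 2^n instead of 2^(mn), at the price of the factor m in
  -- the scale.
  have hcomb := lintegral_exp_sum_le (P := P) Finset.univ (fun _ : Fin m => (m : ℝ)⁻¹)
    (fun _ _ => by positivity) (by simp [hm'.ne'])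
    (fun l ω => ∑ s ∈ Finset.range n, (u s ω l / γ) ^ 2 / 4)
    (fun l => Finset.measurable_fun_sum _ fun s _ => by have := hu s; fun_prop)
    (one_le_pow₀ (by norm_num)) (fun l _ => hY l)
  refine le_trans (le_of_eq ?_) hcomb
  refine lintegral_congr fun ω => ?_
  congr 2
  rw [← Finset.mul_sum, Finset.sum_comm, Finset.mul_sum, Finset.mul_sum]
  refine Finset.sum_congr rfl fun s _ => ?_
  rw [EuclideanSpace.norm_sq_eq, ← Finset.sum_div]
  simp_rw [div_pow, ← Finset.sum_div, Real.norm_eq_abs, sq_abs]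
  field_simp

/-- Doubling η gives a strict inequality, hence an admissible c < 2η, without asking whether the
infimum is attained. -/
theorem lintegral_exp_le_of_psi2Norm_le {Ω : Type*} [MeasurableSpace Ω] {P : Measure Ω}
    {X : Ω → ℝ} {η : ℝ} (hη : 0 < η) (h : psi2Norm X P ≤ ENNReal.ofReal η) :
    ∫⁻ ω, ENNReal.ofReal (Real.exp (X ω ^ 2 / (2 * η) ^ 2)) ∂P ≤ 2 := by
  have h1 : psi2Norm X P < ENNReal.ofReal (2 * η) :=
    h.trans_lt ((ENNReal.ofReal_lt_ofReal_iff (by positivity)).2 (by linarith))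
  simp only [psi2Norm, iInf_lt_iff] at h1
  obtain ⟨c, hc, hint, hlt⟩ := h1
  have hc2 : c < 2 * η := (ENNReal.ofReal_lt_ofReal_iff (by positivity)).1 hlt
  refine le_trans (lintegral_mono fun ω => ENNReal.ofReal_le_ofReal (Real.exp_le_exp.2 ?_)) hint
  gcongr

/-- Iterating conditional exponential moment bounds along the filtration. -/
theorem lintegral_exp_sum_history_le {Ω : Type*} [MeasurableSpace Ω] {P : Measure Ω}
    [IsProbabilityMeasure P] {n : ℕ} {x₀ : Ω → EuclideanSpace ℝ (Fin n)}
    {w : ℕ → Ω → EuclideanSpace ℝ (Fin n)} (hx : Measurable x₀) (hw : ∀ t, Measurable (w t))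
    {f : EuclideanSpace ℝ (Fin n) → ℝ} (hf : Measurable f)
    (h0 : ∫⁻ ω, ENNReal.ofReal (Real.exp (f (x₀ ω))) ∂P ≤ 2)
    (hc : ∀ t, ∀ᵐ h ∂(P.map (history x₀ w t)),
      ∫⁻ z, ENNReal.ofReal (Real.exp (f z)) ∂(condDistrib (w t) (history x₀ w t) P h) ≤ 2)
    (T : ℕ) :
    ∫⁻ ω, ENNReal.ofReal (Real.exp (f (x₀ ω) + ∑ s ∈ Finset.range T, f (w s ω))) ∂P
      ≤ 2 ^ (T + 1) := by
  induction T with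
  | zero => simpa using h0
  | succ T ih =>
    have hH : Measurable (history x₀ w T) :=
      hx.prodMk (measurable_pi_lambda _ fun s => hw s)
    let g (h : EuclideanSpace ℝ (Fin n) × (Fin T → EuclideanSpace ℝ (Fin n))) : ℝ≥0∞ :=
      ENNReal.ofReal (Real.exp (f h.1 + ∑ s, f (h.2 s)))
    have hg : Measurable g := by fun_prop
    have hgH (ω : Ω) : g (history x₀ w T ω)
        = ENNReal.ofReal (Real.exp (f (x₀ ω) + ∑ s ∈ Finset.range T, f (w s ω))) := by
      simp only [g, history]
      rw [Fin.sum_univ_eq_sum_range (fun s => f (w s ω))]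
    have hF : Measurable fun z : (EuclideanSpace ℝ (Fin n) × (Fin T → EuclideanSpace ℝ (Fin n))) ×
        EuclideanSpace ℝ (Fin n) => g z.1 * ENNReal.ofReal (Real.exp (f z.2)) := by fun_prop
    calc ∫⁻ ω, ENNReal.ofReal (Real.exp (f (x₀ ω) + ∑ s ∈ Finset.range (T + 1), f (w s ω))) ∂P
        = ∫⁻ ω, g (history x₀ w T ω) * ENNReal.ofReal (Real.exp (f (w T ω))) ∂P := by
          refine lintegral_congr fun ω => ?_
          rw [hgH, ← ENNReal.ofReal_mul (Real.exp_pos _).le, ← Real.exp_add,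
            Finset.sum_range_succ, add_assoc]
      _ = ∫⁻ z, g z.1 * ENNReal.ofReal (Real.exp (f z.2))
            ∂(P.map fun ω => (history x₀ w T ω, w T ω)) := by
          rw [lintegral_map hF (hH.prodMk (hw T))]
      -- Disintegration of the joint law over the history isolates the conditional moment, which is
      -- at most 2.
      _ = ∫⁻ h, g h * ∫⁻ z, ENNReal.ofReal (Real.exp (f z))
            ∂(condDistrib (w T) (history x₀ w T) P h) ∂(P.map (history x₀ w T)) := by
          rw [← compProd_map_condDistrib (hw T).aemeasurable, Measure.lintegral_compProd hF]
          refine lintegral_congr fun h => ?_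
          exact lintegral_const_mul (g h)
            (ENNReal.measurable_ofReal.comp (Real.measurable_exp.comp hf))
      _ ≤ ∫⁻ h, g h * 2 ∂(P.map (history x₀ w T)) := by
          refine lintegral_mono_ae ?_
          filter_upwards [hc T] with h hh
          gcongr
      _ = (∫⁻ ω, g (history x₀ w T ω) ∂P) * 2 := by
          rw [lintegral_mul_const _ hg, lintegral_map hg hH]
      _ ≤ 2 ^ (T + 1) * 2 := by
          simp_rw [hgH]
          gcongr
      _ = 2 ^ (T + 1 + 1) := (pow_succ _ _).symm

theorem sum_mul_pow_le_div {ρ a : ℝ} (hρ : 0 ≤ ρ) (ha0 : 0 ≤ a) (ha1 : a < 1) (J : ℕ) :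
    ∑ j ∈ Finset.range J, ρ * a ^ j ≤ ρ / (1 - a) := by
  rw [← Finset.mul_sum, le_div_iff₀ (by linarith), mul_assoc, geom_sum_mul_neg]
  have : 0 ≤ a ^ J := by positivity
  nlinarith

/-- The sum of the lengths of geometrically decaying linear images of a sub-Gaussian vector is
sub-Gaussian, with a parameter independent of the dimension of the vector. -/
theorem lintegral_exp_sum_norm_le_of_vecPsi2Norm_le {Ω : Type*} [MeasurableSpace Ω]
    {P : Measure Ω} [IsProbabilityMeasure P] {n r : ℕ} (hr : 1 ≤ r)
    {W : Ω → EuclideanSpace ℝ (Fin n)} (hW : Measurable W) {η : ℝ} (hη : 0 < η)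
    (h : vecPsi2Norm W P ≤ ENNReal.ofReal η)
    (M : ℕ → EuclideanSpace ℝ (Fin n) →L[ℝ] EuclideanSpace ℝ (Fin r)) {ρ a : ℝ} (hρ : 0 < ρ)
    (ha0 : 0 ≤ a) (ha1 : a < 1) (hM : ∀ j, ‖M j‖ ≤ ρ * a ^ j) (J : ℕ) :
    ∫⁻ ω, ENNReal.ofReal (Real.exp ((∑ j ∈ Finset.range J, ‖M j (W ω)‖) ^ 2
      / (4 * (ρ / (1 - a)) ^ 2 * r * η ^ 2))) ∂P ≤ 2 := by
  have ha : 0 < 1 - a := by linarith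
  have hr' : (0 : ℝ) < r := by exact_mod_cast hr
  set K := ρ / (1 - a) with hK
  have hK0 : 0 < K := by positivity
  -- Coordinate i of `M j z` is ρ a^j times the inner product of z with `φ j i`. These lie in the
  -- unit ball, and only r of them are needed for each j, so n does not enter.
  let φ (j : ℕ) (i : Fin r) : EuclideanSpace ℝ (Fin n) :=
    (ρ * a ^ j)⁻¹ • ContinuousLinearMap.adjoint (M j) (EuclideanSpace.single i 1)
  have hφ (j : ℕ) (i : Fin r) : ‖φ j i‖ ≤ 1 := by
    have h0 : 0 ≤ ρ * a ^ j := by positivity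
    have h1 : ‖ContinuousLinearMap.adjoint (M j) (EuclideanSpace.single i 1)‖ ≤ ρ * a ^ j := by
      refine (ContinuousLinearMap.le_opNorm _ _).trans ?_
      rw [LinearIsometryEquiv.norm_map, PiLp.norm_single]
      simpa using hM j
    rw [norm_smul, norm_inv, Real.norm_of_nonneg h0]
    exact inv_mul_le_one_of_le₀ h1 h0
  have hψ (j : ℕ) (i : Fin r) :
      ∫⁻ ω, ENNReal.ofReal (Real.exp (inner ℝ (W ω) (φ j i) ^ 2 / (2 * η) ^ 2)) ∂P ≤ 2 :=
    lintegral_exp_le_of_psi2Norm_le hη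
      ((le_iSup₂ (f := fun (v : EuclideanSpace ℝ (Fin n)) (_ : ‖v‖ ≤ 1) =>
        psi2Norm (fun ω => inner ℝ (W ω) v) P) (φ j i) (hφ j i)).trans h)
  have hnorm (j : ℕ) (z : EuclideanSpace ℝ (Fin n)) :
      ‖M j z‖ ^ 2 = (ρ * a ^ j) * ((ρ * a ^ j) * ∑ i, inner ℝ z (φ j i) ^ 2) := by
    -- For a = 0 and j ≥ 1 the weight vanishes, but so does `M j`.
    rcases eq_or_ne (ρ * a ^ j) 0 with h0 | h0
    · have h1 : ‖M j‖ = 0 := le_antisymm (h0 ▸ hM j) (norm_nonneg _)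
      rw [h0, norm_eq_zero.1 h1]
      simp
    · rw [EuclideanSpace.norm_sq_eq, ← mul_assoc, Finset.mul_sum]
      refine Finset.sum_congr rfl fun i _ => ?_
      rw [inner_smul_right, ContinuousLinearMap.adjoint_inner_right,
        EuclideanSpace.inner_single_right, Real.norm_eq_abs, sq_abs]
      simp only [conj_trivial, one_mul]
      generalize ρ * a ^ j = q at h0 ⊢
      field_simp
  have hpt (z : EuclideanSpace ℝ (Fin n)) : (∑ j ∈ Finset.range J, ‖M j z‖) ^ 2
      / (4 * K ^ 2 * r * η ^ 2) ≤ ∑ c ∈ Finset.range J ×ˢ (Finset.univ : Finset (Fin r)),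
        (ρ * a ^ c.1 / (K * r)) * (inner ℝ z (φ c.1 c.2) ^ 2 / (2 * η) ^ 2) := by
    -- Cauchy–Schwarz with weights ρ a^j, whose sum is at most K; after division by K r they become
    -- subconvex weights over the pairs (j, i).
    have h1 := Finset.sum_sq_le_sum_mul_sum_of_sq_le_mul (Finset.range J)
      (r := fun j => ‖M j z‖) (f := fun j => ρ * a ^ j)
      (g := fun j => (ρ * a ^ j) * ∑ i, inner ℝ z (φ j i) ^ 2)
      (fun _ _ => by positivity) (fun _ _ => by positivity) (fun j _ => (hnorm j z).le)
    have h2 : (∑ j ∈ Finset.range J, ‖M j z‖) ^ 2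
        ≤ K * ∑ j ∈ Finset.range J, (ρ * a ^ j) * ∑ i, inner ℝ z (φ j i) ^ 2 :=
      h1.trans (mul_le_mul_of_nonneg_right (sum_mul_pow_le_div hρ.le ha0 ha1 J)
        (Finset.sum_nonneg fun _ _ => by positivity))
    rw [div_le_iff₀ (by positivity)]
    refine h2.trans (le_of_eq ?_)
    rw [Finset.sum_product, Finset.mul_sum, Finset.sum_mul]
    refine Finset.sum_congr rfl fun j _ => ?_
    dsimp only
    rw [← Finset.mul_sum, ← Finset.sum_div]
    field_simp
    ring
  refine (lintegral_mono fun ω => ENNReal.ofReal_le_ofReal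
    (Real.exp_le_exp.2 (hpt (W ω)))).trans ?_
  refine lintegral_exp_sum_le (P := P) _ (fun c : ℕ × Fin r => ρ * a ^ c.1 / (K * r))
    (fun _ _ => by positivity) ?_
    (fun c ω => inner ℝ (W ω) (φ c.1 c.2) ^ 2 / (2 * η) ^ 2) (fun c => by fun_prop)
    (by norm_num) (fun c _ => hψ c.1 c.2)
  rw [Finset.sum_product]
  simp only [Finset.sum_const, Finset.card_univ, Fintype.card_fin, nsmul_eq_mul]
  calc ∑ j ∈ Finset.range J, (r : ℝ) * (ρ * a ^ j / (K * r))
      = (∑ j ∈ Finset.range J, ρ * a ^ j) / K := by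
        rw [Finset.sum_div]
        exact Finset.sum_congr rfl fun j _ => by field_simp
    _ ≤ 1 := by
        rw [div_le_one hK0]
        exact sum_mul_pow_le_div hρ.le ha0 ha1 J

/-! ### Deterministic analysis of the system and of the minimizer -/

/-- The accumulated output of a linear recursion is bounded by the accumulated responses to the
initial state and to the individual increments. -/
theorem sum_norm_recursion_le {E F : Type*} [NormedAddCommGroup E] [NormedSpace ℝ E]
    [NormedAddCommGroup F] [NormedSpace ℝ F] (A : E →L[ℝ] E) (M : E →L[ℝ] F) (x v : ℕ → E)
    (hx : ∀ t, x (t + 1) = A (x t) + v t) (T J : ℕ) :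
    ∑ t ∈ Finset.range T, ‖M (x t)‖ + ∑ j ∈ Finset.range J, ‖M ((A ^ j) (x T))‖
      ≤ ∑ j ∈ Finset.range (J + T), ‖M ((A ^ j) (x 0))‖
        + ∑ s ∈ Finset.range T, ∑ j ∈ Finset.range (J + T), ‖M ((A ^ j) (v s))‖ := by
  induction T generalizing J with
  | zero => simp
  | succ T ih =>
    have h1 : ∑ j ∈ Finset.range J, ‖M ((A ^ j) (x (T + 1)))‖
        ≤ ∑ j ∈ Finset.range J, ‖M ((A ^ (j + 1)) (x T))‖
          + ∑ j ∈ Finset.range J, ‖M ((A ^ j) (v T))‖ := by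
      rw [← Finset.sum_add_distrib]
      refine Finset.sum_le_sum fun j _ => ?_
      rw [hx, map_add, map_add, pow_succ]
      exact norm_add_le _ _
    have h2 : ∑ j ∈ Finset.range J, ‖M ((A ^ j) (v T))‖
        ≤ ∑ j ∈ Finset.range (J + (T + 1)), ‖M ((A ^ j) (v T))‖ :=
      Finset.sum_le_sum_of_subset_of_nonneg (Finset.range_mono (by omega))
        fun _ _ _ => norm_nonneg _
    have h3 := ih (J + 1)
    rw [Finset.sum_range_succ' _ J] at h3
    rw [show J + 1 + T = J + (T + 1) by omega] at h3
    rw [Finset.sum_range_succ, Finset.sum_range_succ (n := T)]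
    simp only [pow_zero, one_apply_eq_self] at h3
    linarith

/-- The continuous linear map of a matrix between Euclidean spaces. -/
noncomputable def matCLM {a b : ℕ} (M : Matrix (Fin a) (Fin b) ℝ) :
    EuclideanSpace ℝ (Fin b) →L[ℝ] EuclideanSpace ℝ (Fin a) :=
  (Matrix.toEuclideanLin M).toContinuousLinearMap

theorem matCLM_apply {a b : ℕ} (M : Matrix (Fin a) (Fin b) ℝ) (z : EuclideanSpace ℝ (Fin b)) :
    matCLM M z = Matrix.toEuclideanLin M z := rfl

theorem norm_matCLM {a b : ℕ} (M : Matrix (Fin a) (Fin b) ℝ) : ‖matCLM M‖ = specNorm M := rfl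

theorem specNorm_nonneg {a b : ℕ} (M : Matrix (Fin a) (Fin b) ℝ) : 0 ≤ specNorm M :=
  norm_nonneg _

theorem toEuclideanLin_mul_apply {a b c : ℕ} (M : Matrix (Fin a) (Fin b) ℝ)
    (N : Matrix (Fin b) (Fin c) ℝ) (z : EuclideanSpace ℝ (Fin c)) :
    Matrix.toEuclideanLin (M * N) z = Matrix.toEuclideanLin M (Matrix.toEuclideanLin N z) := by
  simp [Matrix.toLpLin_apply, Matrix.mulVec_mulVec]

theorem matCLM_mul {a b c : ℕ} (M : Matrix (Fin a) (Fin b) ℝ) (N : Matrix (Fin b) (Fin c) ℝ) :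
    matCLM (M * N) = (matCLM M).comp (matCLM N) :=
  ContinuousLinearMap.ext fun z => toEuclideanLin_mul_apply M N z

theorem matCLM_pow {n : ℕ} (A : Matrix (Fin n) (Fin n) ℝ) (j : ℕ) :
    matCLM (A ^ j) = matCLM A ^ j := by
  induction j with
  | zero => ext z; simp [matCLM_apply]
  | succ j ih => rw [pow_succ, matCLM_mul, ih, pow_succ]; rfl

theorem specNorm_mul_le {a b c : ℕ} (M : Matrix (Fin a) (Fin b) ℝ)
    (N : Matrix (Fin b) (Fin c) ℝ) : specNorm (M * N) ≤ specNorm M * specNorm N := by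
  rw [← norm_matCLM, matCLM_mul]
  exact ContinuousLinearMap.opNorm_comp_le _ _

theorem norm_pow_le_pow_norm {E : Type*} [NormedAddCommGroup E] [NormedSpace ℝ E]
    (A : E →L[ℝ] E) (j : ℕ) : ‖A ^ j‖ ≤ ‖A‖ ^ j := by
  induction j with
  | zero => simpa using! ContinuousLinearMap.norm_id_le
  | succ j ih =>
    rw [pow_succ, pow_succ]
    exact (norm_mul_le _ _).trans (mul_le_mul_of_nonneg_right ih (norm_nonneg _))

theorem specNorm_pow_le {n : ℕ} (A : Matrix (Fin n) (Fin n) ℝ) (j : ℕ) :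
    specNorm (A ^ j) ≤ specNorm A ^ j := by
  rw [← norm_matCLM, matCLM_pow]
  exact norm_pow_le_pow_norm _ _

section System

variable {n m r k : ℕ} {A : Matrix (Fin n) (Fin n) ℝ} {B : Matrix (Fin n) (Fin m) ℝ}
  {C : Matrix (Fin r) (Fin n) ℝ} {D : Matrix (Fin r) (Fin m) ℝ}
  {x w : ℕ → EuclideanSpace ℝ (Fin n)} {u : ℕ → EuclideanSpace ℝ (Fin m)}
  {y : ℕ → EuclideanSpace ℝ (Fin r)}

theorem state_eq_of_attack_free
    (hx : ∀ t, x (t + 1) = Matrix.toEuclideanLin A (x t) + Matrix.toEuclideanLin B (u t) + w t)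
    (s l : ℕ) (hw : ∀ j < l, w (s + j) = 0) :
    x (s + l) = Matrix.toEuclideanLin (A ^ l) (x s)
      + ∑ j ∈ Finset.range l, Matrix.toEuclideanLin (A ^ j * B) (u (s + l - 1 - j)) := by
  induction l with
  | zero => simp
  | succ l ih =>
    rw [← add_assoc, hx, ih fun j hj => hw j (by omega), hw l (by omega), add_zero,
      Finset.sum_range_succ', map_add, map_sum, ← toEuclideanLin_mul_apply, ← pow_succ']
    simp only [pow_zero, Matrix.one_mul]
    rw [add_assoc]
    congr 2
    · refine Finset.sum_congr rfl fun j hj => ?_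
      rw [← toEuclideanLin_mul_apply, ← Matrix.mul_assoc, ← pow_succ']
      congr 2
      omega

/-- The output at a time that is preceded by an attack-free window. -/
theorem output_eq_of_attack_free (hk : 1 ≤ k)
    (hx : ∀ t, x (t + 1) = Matrix.toEuclideanLin A (x t) + Matrix.toEuclideanLin B (u t) + w t)
    (hy : ∀ t, y t = Matrix.toEuclideanLin C (x t) + Matrix.toEuclideanLin D (u t))
    {t : ℕ} (ht : 2 * k - 1 ≤ t) (hw : ∀ s ∈ Finset.Ico (t - (2 * k - 1)) t, w s = 0) (i : Fin r) :
    y t i = ((markovMatrix k A B C D).mulVec (stackedInput k u t)) i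
      + matCLM (C * A ^ (2 * k - 1)) (x (t - (2 * k - 1))) i := by
  obtain ⟨L, hL⟩ : ∃ L, 2 * k = L + 1 := ⟨2 * k - 1, by omega⟩
  have hL' : 2 * k - 1 = L := by omega
  rw [hL'] at ht hw ⊢
  have hst := state_eq_of_attack_free hx (t - L) L fun j hj =>
    hw _ (Finset.mem_Ico.2 ⟨by omega, by omega⟩)
  rw [show t - L + L = t by omega] at hst
  rw [hy, hst, map_add, ← toEuclideanLin_mul_apply, map_sum, matCLM_apply]
  have hmv : ((markovMatrix k A B C D).mulVec (stackedInput k u t)) i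
      = ∑ j ∈ Finset.range (L + 1), ∑ l : Fin m,
        (if j = 0 then D i l else (C * A ^ (j - 1) * B) i l) * u (t - j) l := by
    rw [← hL, ← Fin.sum_univ_eq_sum_range (fun j => ∑ l : Fin m,
        (if j = 0 then D i l else (C * A ^ (j - 1) * B) i l) * u (t - j) l)]
    simp only [Matrix.mulVec, dotProduct, markovMatrix, stackedInput, Matrix.of_apply]
    rw [Fintype.sum_prod_type]
  rw [hmv, Finset.sum_range_succ']
  have happ (a b : ℕ) (Q : Matrix (Fin a) (Fin b) ℝ) (v : EuclideanSpace ℝ (Fin b)) (i : Fin a) :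
      Matrix.toEuclideanLin Q v i = ∑ l, Q i l * v l := by
    simp [Matrix.toLpLin_apply, Matrix.mulVec, dotProduct]
  have hterm : (∑ j ∈ Finset.range L, Matrix.toEuclideanLin C
      (Matrix.toEuclideanLin (A ^ j * B) (u (t - 1 - j)))) i
      = ∑ j ∈ Finset.range L, ∑ l : Fin m, (C * A ^ j * B) i l * u (t - (j + 1)) l := by
    have h1 : ∀ s : Finset ℕ, ∀ f : ℕ → EuclideanSpace ℝ (Fin r),
        (∑ j ∈ s, f j) i = ∑ j ∈ s, f j i := fun s f => by simp
    rw [h1]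
    refine Finset.sum_congr rfl fun j _ => ?_
    rw [← toEuclideanLin_mul_apply, ← Matrix.mul_assoc, happ]
    rw [show t - 1 - j = t - (j + 1) by omega]
  simp only [PiLp.add_apply]
  rw [hterm, happ r m D]
  simp only [Nat.add_eq_zero_iff, one_ne_zero, and_false, if_false, if_true, Nat.add_sub_cancel,
    Nat.sub_zero]
  ring

/-- The basic inequality for one row of an `ℓ₁`-norm estimate. -/
theorem signed_sum_row_le (hk : 1 ≤ k) {T : ℕ}
    (hx : ∀ t, x (t + 1) = Matrix.toEuclideanLin A (x t) + Matrix.toEuclideanLin B (u t) + w t)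
    (hy : ∀ t, y t = Matrix.toEuclideanLin C (x t) + Matrix.toEuclideanLin D (u t))
    {z : ℕ → Bool} (hw : ∀ s, z s = false → w s = 0)
    {G : Matrix (Fin r) (Fin (2 * k) × Fin m) ℝ} (hG : IsL1Estimate k T u y G) (i : Fin r) :
    ∑ t ∈ Finset.Icc (2 * k - 1) (T + 2 * k - 2), attackSign k z t
        * |inner ℝ (WithLp.toLp 2 ((markovMatrix k A B C D - G) i)) (stackedVec k u t)|
      ≤ 2 * ∑ s ∈ Finset.range T, |matCLM (C * A ^ (2 * k - 1)) (x s) i| := by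
  classical
  set Gs := markovMatrix k A B C D with hGs
  set J := Finset.Icc (2 * k - 1) (T + 2 * k - 2) with hJ
  -- The loss separates over rows, so `G` is compared with the matrix in which only row `i` is
  -- replaced by the true one.
  have hrow : ∑ t ∈ J, |y t i - (G.mulVec (stackedInput k u t)) i|
      ≤ ∑ t ∈ J, |y t i - (Gs.mulVec (stackedInput k u t)) i| := by
    have hself (v) : ((G.updateRow i (Gs i)).mulVec v) i = (Gs.mulVec v) i := by
      change (fun j => G.updateRow i (Gs i) i j) ⬝ᵥ v = _
      simp only [Matrix.updateRow_self]
      rfl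
    have hne (v) (i') (h : i' ≠ i) : ((G.updateRow i (Gs i)).mulVec v) i' = (G.mulVec v) i' := by
      change (fun j => G.updateRow i (Gs i) i' j) ⬝ᵥ v = _
      simp only [Matrix.updateRow_ne h]
      rfl
    have h1 := hG (G.updateRow i (Gs i))
    simp only [l1Loss] at h1
    rw [← hJ, Finset.sum_comm, Finset.sum_comm (s := J)] at h1
    rw [← Finset.add_sum_erase _ _ (Finset.mem_univ i),
      ← Finset.add_sum_erase (a := i) _ _ (Finset.mem_univ i)] at h1
    have h2 : ∀ i' ∈ Finset.univ.erase i, ∑ t ∈ J,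
        |y t i' - (Matrix.mulVec (G.updateRow i (Gs i)) (stackedInput k u t)) i'|
        = ∑ t ∈ J, |y t i' - (G.mulVec (stackedInput k u t)) i'| := by
      intro i' hi'
      refine Finset.sum_congr rfl fun t _ => ?_
      rw [hne _ _ (Finset.ne_of_mem_erase hi')]
    rw [Finset.sum_congr rfl h2] at h1
    simpa only [hself] using le_of_add_le_add_right h1
  have hin (t : ℕ) : inner ℝ (WithLp.toLp 2 ((Gs - G) i)) (stackedVec k u t)
      = (Gs.mulVec (stackedInput k u t)) i - (G.mulVec (stackedInput k u t)) i := by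
    rw [inner_stackedVec]
    simp [Matrix.mulVec, dotProduct, sub_mul, Finset.sum_sub_distrib]
  have hterm : ∀ t ∈ J, attackSign k z t
        * |inner ℝ (WithLp.toLp 2 ((Gs - G) i)) (stackedVec k u t)|
      ≤ (|y t i - (G.mulVec (stackedInput k u t)) i|
        - |y t i - (Gs.mulVec (stackedInput k u t)) i|)
        + 2 * |matCLM (C * A ^ (2 * k - 1)) (x (t - (2 * k - 1))) i| := by
    intro t ht
    rw [hin]
    set a := (Gs.mulVec (stackedInput k u t)) i
    set b := (G.mulVec (stackedInput k u t)) i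
    by_cases hcl : ∀ s ∈ Finset.Ico (t - (2 * k - 1)) t, z s = false
    · have he := output_eq_of_attack_free hk hx hy (Finset.mem_Icc.1 ht).1
        (fun s hs => hw s (hcl s hs)) i
      rw [attackSign, if_pos hcl, one_mul]
      have h1 : y t i - a = matCLM (C * A ^ (2 * k - 1)) (x (t - (2 * k - 1))) i := by
        rw [he]; ring
      rw [← h1]
      have := abs_sub (y t i - b) (y t i - a)
      rw [show y t i - b - (y t i - a) = a - b by ring] at this
      linarith
    -- After an attack nothing is known about the residual, but replacing the row changes it by
    -- exactly a - b, so the loss is at most |a - b|.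
    · rw [attackSign, if_neg hcl]
      have h1 : y t i - a = (y t i - b) - (a - b) := by ring
      have := abs_sub (y t i - b) (a - b)
      rw [← h1] at this
      have := abs_nonneg (matCLM (C * A ^ (2 * k - 1)) (x (t - (2 * k - 1))) i)
      linarith
  have hshift : ∑ t ∈ J, |matCLM (C * A ^ (2 * k - 1)) (x (t - (2 * k - 1))) i|
      = ∑ s ∈ Finset.range T, |matCLM (C * A ^ (2 * k - 1)) (x s) i| := by
    have hJ2 : J = Finset.Ico (2 * k - 1) (2 * k - 1 + T) := by
      ext t
      rw [hJ, Finset.mem_Icc, Finset.mem_Ico]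
      omega
    rw [hJ2, Finset.sum_Ico_eq_sum_range, Nat.add_sub_cancel_left]
    exact Finset.sum_congr rfl fun s _ => by rw [Nat.add_sub_cancel_left]
  calc _ ≤ ∑ t ∈ J, ((|y t i - (G.mulVec (stackedInput k u t)) i|
        - |y t i - (Gs.mulVec (stackedInput k u t)) i|)
        + 2 * |matCLM (C * A ^ (2 * k - 1)) (x (t - (2 * k - 1))) i|) := Finset.sum_le_sum hterm
    _ ≤ _ := by
      rw [Finset.sum_add_distrib, Finset.sum_sub_distrib, ← Finset.mul_sum, hshift]
      linarith

/-- Taking the Euclidean norm over the rows before the triangle inequality in time keeps ‖a_s‖ on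
the right, with no additional factor √r. -/
theorem mul_frobNorm_le_of_rows {ι : Type*} [Fintype ι] {r T : ℕ} (Q : Matrix (Fin r) ι ℝ) {κ : ℝ}
    (hκ : 0 ≤ κ) (a : ℕ → EuclideanSpace ℝ (Fin r))
    (h : ∀ i, κ * ‖(WithLp.toLp 2 (Q i) : EuclideanSpace ℝ ι)‖
      ≤ 2 * ∑ s ∈ Finset.range T, |a s i|) :
    κ * frobNorm Q ≤ 2 * ∑ s ∈ Finset.range T, ‖a s‖ := by
  let b (s : ℕ) : EuclideanSpace ℝ (Fin r) := WithLp.toLp 2 fun i => |a s i|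
  have hb (s : ℕ) : ‖b s‖ = ‖a s‖ := by
    rw [EuclideanSpace.norm_eq, EuclideanSpace.norm_eq]
    simp [b]
  have h1 : κ * frobNorm Q ≤ ‖(2 : ℝ) • ∑ s ∈ Finset.range T, b s‖ := by
    rw [EuclideanSpace.norm_eq, frobNorm, ← Real.sqrt_sq hκ, ← Real.sqrt_mul (sq_nonneg κ)]
    refine Real.sqrt_le_sqrt ?_
    rw [Finset.mul_sum]
    refine Finset.sum_le_sum fun i _ => ?_
    have h2 : κ ^ 2 * ∑ j, Q i j ^ 2
        = (κ * ‖(WithLp.toLp 2 (Q i) : EuclideanSpace ℝ ι)‖) ^ 2 := by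
      rw [mul_pow, EuclideanSpace.norm_sq_eq]
      simp
    have h3 : ((2 : ℝ) • ∑ s ∈ Finset.range T, b s) i = 2 * ∑ s ∈ Finset.range T, |a s i| := by
      simp [b]
    rw [h2, h3, Real.norm_eq_abs, sq_abs]
    exact pow_le_pow_left₀ (by positivity) (h i) 2
  refine h1.trans ?_
  rw [norm_smul, Real.norm_of_nonneg (by norm_num)]
  refine mul_le_mul_of_nonneg_left ((norm_sum_le _ _).trans (le_of_eq ?_)) (by norm_num)
  exact Finset.sum_congr rfl fun s _ => hb s

end System

/-! ### Tail bounds and sample size -/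

/-- The length of the sum of lengths, from the sum of squared lengths. -/
theorem sum_le_of_sum_sq_le {ι : Type*} (J : Finset ι) (f : ι → ℝ) {c Q b : ℝ}
    (hcard : (J.card : ℝ) ≤ c) (hQ : ∑ t ∈ J, f t ^ 2 ≤ Q) (hb : 0 ≤ b) (h : c * Q ≤ b ^ 2) :
    ∑ t ∈ J, f t ≤ b := by
  have h1 := sq_sum_le_card_mul_sum_sq (s := J) (f := f)
  have h2 : 0 ≤ ∑ t ∈ J, f t ^ 2 := Finset.sum_nonneg fun _ _ => sq_nonneg _
  have h3 : (J.card : ℝ) * ∑ t ∈ J, f t ^ 2 ≤ c * Q :=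
    mul_le_mul hcard hQ h2 ((Nat.cast_nonneg _).trans hcard)
  exact abs_le_of_sq_le_sq' (h1.trans (h3.trans h)) hb |>.2

theorem two_pow_eq_ofReal_exp (n : ℕ) :
    (2 : ℝ≥0∞) ^ n = ENNReal.ofReal (Real.exp (n * Real.log 2)) := by
  rw [Real.exp_nat_mul, Real.exp_log (by norm_num), ENNReal.ofReal_pow (by norm_num)]
  simp

/-- The energy of the Gaussian inputs is of the expected order with overwhelming probability. -/
theorem measure_input_energy_gt_le {Ω : Type*} [MeasurableSpace Ω] {P : Measure Ω} {m : ℕ}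
    (hm : 1 ≤ m) {γ : ℝ} (hγ : 0 < γ) {u : ℕ → Ω → EuclideanSpace ℝ (Fin m)}
    (hu : ∀ t, Measurable (u t)) (hind : iIndepFun u P)
    (hlaw : ∀ t, HasLaw (u t) (multivariateGaussian 0 (γ ^ 2 • (1 : Matrix (Fin m) (Fin m) ℝ))) P)
    {n T : ℕ} (hn : n ≤ 2 * T) {ε : ℝ} (hε : Real.exp (-(T : ℝ)) ≤ ε) :
    P {ω | 12 * m * γ ^ 2 * T < ∑ s ∈ Finset.range n, ‖u s ω‖ ^ 2} ≤ ENNReal.ofReal ε := by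
  have hm' : (0 : ℝ) < m := by exact_mod_cast hm
  have h1 := lintegral_exp_sum_norm_sq_le hm hγ hu hind hlaw n
  rw [two_pow_eq_ofReal_exp] at h1
  -- As n log 2 ≤ 2T, the level 3T leaves probability e^(-T); the scale 4mγ² turns it into 12mγ²T.
  have h2 := measure_gt_le_of_exp_moment (P := P)
    (Finset.measurable_fun_sum _ (fun s _ => (hu s).norm.pow_const 2) |>.const_mul _)
    (s := 3 * T) (ε := ε) h1 (by
      refine le_trans (Real.exp_le_exp.2 ?_) hε
      have : (n : ℝ) ≤ 2 * T := by exact_mod_cast hn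
      have h3 : Real.log 2 ≤ 1 := by have := Real.log_two_lt_d9; linarith
      nlinarith [Nat.cast_nonneg (α := ℝ) n])
  refine le_trans (measure_mono fun ω hω => ?_) h2
  simp only [Set.mem_ofPred_eq] at hω ⊢
  rw [lt_inv_mul_iff₀ (by positivity)]
  linarith

/-- The accumulated response to the initial state and the attacks, with overwhelming
probability. -/
theorem measure_attack_response_gt_le {Ω : Type*} [MeasurableSpace Ω] {P : Measure Ω}
    [IsProbabilityMeasure P] {n r : ℕ} (hr : 1 ≤ r) {x₀ : Ω → EuclideanSpace ℝ (Fin n)}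
    {w : ℕ → Ω → EuclideanSpace ℝ (Fin n)} (hx : Measurable x₀) (hw : ∀ t, Measurable (w t))
    {η : ℝ} (hη : 0 < η) (hx₀ : vecPsi2Norm x₀ P ≤ ENNReal.ofReal η)
    (hwη : ∀ t, CondPsi2Le P (w t) (history x₀ w t) η)
    (M : ℕ → EuclideanSpace ℝ (Fin n) →L[ℝ] EuclideanSpace ℝ (Fin r)) {ρ a : ℝ} (hρ : 0 ≤ ρ)
    (ha0 : 0 ≤ a) (ha1 : a < 1) (hM : ∀ j, ‖M j‖ ≤ ρ * a ^ j) (J : ℕ)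
    {T : ℕ} (hT : 1 ≤ T) {ε : ℝ} (hε : Real.exp (-(T : ℝ)) ≤ ε) :
    P {ω | 5 * (ρ / (1 - a)) * √(r : ℝ) * η * T < ∑ j ∈ Finset.range J, ‖M j (x₀ ω)‖
        + ∑ s ∈ Finset.range T, ∑ j ∈ Finset.range J, ‖M j (w s ω)‖} ≤ ENNReal.ofReal ε := by
  have ha : 0 < 1 - a := by linarith
  rcases hρ.eq_or_lt with rfl | hρ
  · have h0 (j : ℕ) : M j = 0 := norm_eq_zero.1 (le_antisymm (by simpa using hM j) (norm_nonneg _))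
    simp [h0]
  set K := ρ / (1 - a) with hK
  have hK0 : 0 < K := by positivity
  have hr' : (0 : ℝ) < r := by exact_mod_cast hr
  have hT' : (1 : ℝ) ≤ T := by exact_mod_cast hT
  let N (z : EuclideanSpace ℝ (Fin n)) : ℝ := ∑ j ∈ Finset.range J, ‖M j z‖
  have hN0 (z) : 0 ≤ N z := Finset.sum_nonneg fun _ _ => norm_nonneg _
  have hNm : Measurable N := by fun_prop
  let f (z : EuclideanSpace ℝ (Fin n)) : ℝ := N z ^ 2 / (4 * K ^ 2 * r * η ^ 2)
  have hf : Measurable f := by fun_prop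
  have hmain := lintegral_exp_sum_history_le hx hw hf
    (lintegral_exp_sum_norm_le_of_vecPsi2Norm_le hr hx hη hx₀ M hρ ha0 ha1 hM J)
    (fun t => (hwη t).mono fun h hh =>
      lintegral_exp_sum_norm_le_of_vecPsi2Norm_le hr measurable_id hη hh M hρ ha0 ha1 hM J) T
  rw [two_pow_eq_ofReal_exp] at hmain
  have hcher := measure_gt_le_of_exp_moment (P := P)
    ((hf.comp hx).add (Finset.measurable_fun_sum _ fun s _ => hf.comp (hw s)))
    (s := 3 * T) (ε := ε) hmain (by
      refine le_trans (Real.exp_le_exp.2 ?_) hε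
      have h3 : Real.log 2 ≤ 1 := by have := Real.log_two_lt_d9; linarith
      push_cast
      nlinarith)
  refine le_trans (measure_mono fun ω hω => ?_) hcher
  simp only [Set.mem_ofPred_eq] at hω ⊢
  by_contra hle
  rw [not_lt] at hle
  refine absurd hω (not_lt.2 ?_)
  let v (s : ℕ) : EuclideanSpace ℝ (Fin n) := if s = 0 then x₀ ω else w (s - 1) ω
  have hsum (g : EuclideanSpace ℝ (Fin n) → ℝ) : g (x₀ ω) + ∑ s ∈ Finset.range T, g (w s ω)
      = ∑ s ∈ Finset.range (T + 1), g (v s) := by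
    rw [Finset.sum_range_succ', add_comm]
    simp [v]
  change N (x₀ ω) + ∑ s ∈ Finset.range T, N (w s ω) ≤ _
  change f (x₀ ω) + ∑ s ∈ Finset.range T, f (w s ω) ≤ _ at hle
  rw [hsum N]
  rw [hsum f] at hle
  -- There are T + 1 ≤ 2T terms, and Cauchy–Schwarz gives 2 · 3 · 4 = 24 ≤ 5².
  refine sum_le_of_sum_sq_le _ _ (c := 2 * T) (Q := 3 * T * (4 * K ^ 2 * r * η ^ 2)) ?_ ?_
    (by positivity) ?_
  · rw [Finset.card_range]
    push_cast
    linarith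
  · simp only [f] at hle
    rwa [← Finset.sum_div, div_le_iff₀ (by positivity)] at hle
  · have : √(r : ℝ) ^ 2 = r := Real.sq_sqrt hr'.le
    calc 2 * (T : ℝ) * (3 * T * (4 * K ^ 2 * r * η ^ 2)) = 24 * (K ^ 2 * r * η ^ 2 * T ^ 2) := by
          ring
      _ ≤ 25 * (K ^ 2 * r * η ^ 2 * T ^ 2) := by
          have : 0 ≤ K ^ 2 * r * η ^ 2 * T ^ 2 := by positivity
          linarith
      _ = (5 * K * √(r : ℝ) * η * T) ^ 2 := by
          rw [mul_pow, mul_pow, mul_pow, mul_pow, this]; ring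

/-- The sample size condition with the lower order terms made explicit. -/
theorem sample_size_le {k m : ℕ} (hk : 1 ≤ k) (hm : 1 ≤ m) {θ δ r T : ℝ} (hθ0 : 0 < θ)
    (hθ1 : θ ≤ 1) (hδ : 0 < δ) (hδ1 : δ ≤ 1) (hr : 1 ≤ r) (hT1 : 40000 ≤ T)
    (hT : 40000 * ((k : ℝ) / θ ^ 2 * ((k : ℝ) * m * Real.log ((k : ℝ) * m / θ)
      + Real.log (r / δ))) ≤ T) :
    288 * ((k : ℝ) / θ ^ 2 * ((k : ℝ) * m * (16 + 2 * Real.log ((k : ℝ) * m / θ))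
      + Real.log (1 / δ))) ≤ T := by
  have hk' : (1 : ℝ) ≤ k := by exact_mod_cast hk
  have hm' : (1 : ℝ) ≤ m := by exact_mod_cast hm
  have hkm : (1 : ℝ) ≤ (k : ℝ) * m := by nlinarith
  set ℓ := Real.log ((k : ℝ) * m / θ)
  have hlam0 : 0 ≤ Real.log (1 / δ) := Real.log_nonneg (by rw [le_div_iff₀ hδ]; linarith)
  have hlam : Real.log (1 / δ) ≤ Real.log (r / δ) :=
    Real.log_le_log (by positivity) (by gcongr)
  set lam := Real.log (1 / δ)
  have hℓ0 : 0 ≤ ℓ := Real.log_nonneg (by rw [le_div_iff₀ hθ0]; linarith)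
  have hc0 : 0 < (k : ℝ) / θ ^ 2 := by positivity
  have hT2 : 40000 * ((k : ℝ) / θ ^ 2 * ((k : ℝ) * m * ℓ + lam)) ≤ T := by
    refine le_trans ?_ hT
    gcongr
  have hX : 0 ≤ (k : ℝ) / θ ^ 2 * ((k : ℝ) * m * ℓ + lam) := by positivity
  -- If km/θ ≥ 2, the logarithm is at least 1/2 and absorbs the constant 16. Otherwise k = m = 1 and
  -- θ > 1/2; the logarithm may vanish, and the assumption that T exceeds an absolute constant takes
  -- over.
  rcases le_or_gt 2 ((k : ℝ) * m / θ) with h2 | h2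
  · have hℓ : 1 / 2 ≤ ℓ := by
      have h3 := Real.log_le_log (by norm_num) h2
      have := Real.log_two_gt_d9
      linarith
    have h4 : (k : ℝ) * m * (16 + 2 * ℓ) + lam ≤ 34 * ((k : ℝ) * m * ℓ + lam) := by nlinarith
    have h5 := mul_le_mul_of_nonneg_left h4 hc0.le
    nlinarith
  · have h3 : (k : ℝ) * m < 2 := by
      rw [div_lt_iff₀ hθ0] at h2; linarith
    have h4 : k * m < 2 := by exact_mod_cast h3
    have hk1 : k = 1 := by nlinarith
    have hm1 : m = 1 := by nlinarith
    subst hk1 hm1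
    simp only [Nat.cast_one, one_mul, mul_one] at *
    have hθ2 : 1 / 2 < θ := by
      rw [div_lt_iff₀ hθ0] at h2; linarith
    have h5 : 1 / θ ^ 2 ≤ 4 := by
      rw [div_le_iff₀ (by positivity)]; nlinarith
    have h6 : 1 / θ ^ 2 * (16 + 2 * ℓ + lam)
        ≤ 16 * (1 / θ ^ 2) + 2 * (1 / θ ^ 2 * (ℓ + lam)) := by nlinarith
    linarith

/-- For each of the 2k lags the map t ↦ t - j is injective, so every input is counted at most 2k
times. -/
theorem sum_norm_stackedVec_sq_le {m k T : ℕ} (u : ℕ → EuclideanSpace ℝ (Fin m)) :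
    ∑ t ∈ Finset.Icc (2 * k - 1) (T + 2 * k - 2), ‖stackedVec k u t‖ ^ 2
      ≤ 2 * k * ∑ s ∈ Finset.range (T + 2 * k - 1), ‖u s‖ ^ 2 := by
  have h1 (t : ℕ) : ‖stackedVec k u t‖ ^ 2 = ∑ j : Fin (2 * k), ‖u (t - j)‖ ^ 2 := by
    rw [EuclideanSpace.norm_sq_eq, Fintype.sum_prod_type]
    refine Finset.sum_congr rfl fun j _ => ?_
    rw [EuclideanSpace.norm_sq_eq]
    rfl
  simp_rw [h1]
  rw [Finset.sum_comm]
  calc _ ≤ ∑ _j : Fin (2 * k), ∑ s ∈ Finset.range (T + 2 * k - 1), ‖u s‖ ^ 2 := by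
        refine Finset.sum_le_sum fun j _ => ?_
        have hj := j.2
        have hinj : Set.InjOn (fun t => t - (j : ℕ))
            (Finset.Icc (2 * k - 1) (T + 2 * k - 2) : Set ℕ) := by
          intro a ha b hb hab
          simp only [Finset.coe_Icc, Set.mem_Icc] at ha hb hab
          omega
        rw [← Finset.sum_image (f := fun s => ‖u s‖ ^ 2) (g := fun t => t - (j : ℕ)) hinj]
        refine Finset.sum_le_sum_of_subset_of_nonneg ?_ fun _ _ _ => by positivity
        intro s hs
        obtain ⟨t, ht, rfl⟩ := Finset.mem_image.1 hs
        rw [Finset.mem_Icc] at ht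
        rw [Finset.mem_range]
        omega
    _ = _ := by simp

/-- The rounding resolution is fine enough for a uniform lower bound in all directions. -/
theorem le_signed_sum_of_energy {m k T : ℕ} (hk : 1 ≤ k) (hm : 1 ≤ m) (hT : 1 ≤ T) {θ γ : ℝ}
    (hθ0 : 0 < θ) (hθ1 : θ ≤ 1) (hγ : 0 < γ) (u : ℕ → EuclideanSpace ℝ (Fin m)) (σ : ℕ → ℝ)
    (hσ : ∀ t, |σ t| = 1)
    (hE : ∑ s ∈ Finset.range (T + 2 * k - 1), ‖u s‖ ^ 2 ≤ 12 * m * γ ^ 2 * T)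
    {N : ℕ} (hN : 260 * ((k : ℝ) * m / θ) ≤ N)
    (h : ∀ v : EuclideanSpace ℝ (Fin (2 * k) × Fin m),
      (∃ z : Fin (2 * k) × Fin m → ℤ, (∀ i, |z i| ≤ N) ∧ ∀ i, v i = z i) →
      θ * γ * T / 24 * ‖v‖ ≤ ∑ t ∈ Finset.Icc (2 * k - 1) (T + 2 * k - 2),
        σ t * |inner ℝ v (stackedVec k u t)|)
    (Δ : EuclideanSpace ℝ (Fin (2 * k) × Fin m)) :
    θ * γ * T / 96 * ‖Δ‖ ≤ ∑ t ∈ Finset.Icc (2 * k - 1) (T + 2 * k - 2),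
        σ t * |inner ℝ Δ (stackedVec k u t)| := by
  have hk' : (1 : ℝ) ≤ k := by exact_mod_cast hk
  have hm' : (1 : ℝ) ≤ m := by exact_mod_cast hm
  have hT' : (1 : ℝ) ≤ T := by exact_mod_cast hT
  set d : ℝ := 2 * k * m with hd
  have hd1 : 1 ≤ d := by nlinarith
  have hcard : ((Fintype.card (Fin (2 * k) × Fin m) : ℕ) : ℝ) = d := by
    simp [hd]
  have hsd : √d ^ 2 = d := Real.sq_sqrt (by linarith)
  have hsd1 : √d ≤ d := by
    rw [Real.sqrt_le_left (by linarith)]; nlinarith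
  have hb : ∑ t ∈ Finset.Icc (2 * k - 1) (T + 2 * k - 2), ‖stackedVec k u t‖ ≤ 4 * √d * γ * T := by
    refine sum_le_of_sum_sq_le _ _ (c := T) (Q := 2 * k * (12 * m * γ ^ 2 * T)) ?_ ?_
      (by positivity) ?_
    · rw [Nat.card_Icc]
      have : T + 2 * k - 2 + 1 - (2 * k - 1) = T := by omega
      rw [this]
    · refine (sum_norm_stackedVec_sq_le u).trans ?_
      gcongr
    · calc (T : ℝ) * (2 * k * (12 * m * γ ^ 2 * T)) = 12 * (d * γ ^ 2 * T ^ 2) := by rw [hd]; ring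
        _ ≤ 16 * (d * γ ^ 2 * T ^ 2) := by
          have : 0 ≤ d * γ ^ 2 * T ^ 2 := by positivity
          linarith
        _ = (4 * √d * γ * T) ^ 2 := by rw [mul_pow, mul_pow, mul_pow, hsd]; ring
  have hmain := le_signed_sum_of_integer _ (stackedVec k u) σ hσ N (by positivity) h hb Δ
  rw [hcard] at hmain
  -- Lowering 1/24 to 1/96 frees Nθ/32 ≥ 130d/32, which covers the rounding losses 4d and θ√d/24.
  have hNd : 130 * d ≤ N * θ := by
    rw [mul_div_assoc', div_le_iff₀ hθ0] at hN
    linarith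
  have hN0 : (0 : ℝ) < N := by
    have : 0 < N * θ := by linarith
    exact pos_of_mul_pos_left this hθ0.le
  have hcoef : N * (θ * γ * T / 96) ≤ θ * γ * T / 24 * (N - √d) - √d * (4 * √d * γ * T) := by
    have e : √d * (4 * √d * γ * T) = 4 * d * (γ * T) := by
      calc √d * (4 * √d * γ * T) = 4 * √d ^ 2 * (γ * T) := by ring
        _ = _ := by rw [hsd]
    have h1 : θ * √d ≤ d := by nlinarith [Real.sqrt_nonneg d]
    have h2 : 0 ≤ γ * T := by positivity
    have h3 : N * θ / 96 ≤ N * θ / 24 - θ * √d / 24 - 4 * d := by linarith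
    have h4 := mul_le_mul_of_nonneg_right h3 h2
    rw [e]
    linarith
  have h5 := (mul_le_mul_of_nonneg_right hcoef (norm_nonneg Δ)).trans hmain
  rw [mul_assoc] at h5
  exact le_of_mul_le_mul_left h5 hN0

/-- The union bound over the integer vectors is affordable at the given sample size. -/
theorem card_mul_exp_le {k m T N : ℕ} (hk : 1 ≤ k) (hm : 1 ≤ m) {θ δ : ℝ} (hθ0 : 0 < θ)
    (hθ1 : θ ≤ 1) (hδ : 0 < δ) (hN : (N : ℝ) ≤ 260 * ((k : ℝ) * m / θ) + 1)
    (hT : 288 * ((k : ℝ) / θ ^ 2 * ((k : ℝ) * m * (16 + 2 * Real.log ((k : ℝ) * m / θ))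
      + Real.log (1 / δ))) ≤ T) :
    (2 * (N : ℝ) + 1) ^ (2 * k * m) * Real.exp (-(θ ^ 2 * T / (288 * k))) ≤ δ / 3 := by
  have hk' : (1 : ℝ) ≤ k := by exact_mod_cast hk
  have hm' : (1 : ℝ) ≤ m := by exact_mod_cast hm
  have hkm : (1 : ℝ) ≤ (k : ℝ) * m := by nlinarith
  set X := (k : ℝ) * m / θ with hX
  have hX1 : 1 ≤ X := by rw [hX, le_div_iff₀ hθ0]; linarith
  -- Indeed 2N + 1 ≤ 520X + 3 ≤ 523X ≤ e^7 X. The union bound then costs 2km(7 + log X), and 16km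
  -- leaves 2km ≥ 2 ≥ log 3 for the split of δ.
  have h1 : 2 * (N : ℝ) + 1 ≤ Real.exp (7 + Real.log X) := by
    rw [Real.exp_add, Real.exp_log (by linarith)]
    have h2 : (523 : ℝ) ≤ Real.exp 7 := by
      have h3 : Real.exp 7 = Real.exp 1 ^ 7 := by rw [← Real.exp_nat_mul]; norm_num
      rw [h3]
      have h4 : (2.7 : ℝ) ≤ Real.exp 1 := by have := Real.exp_one_gt_d9; linarith
      calc (523 : ℝ) ≤ 2.7 ^ 7 := by norm_num
        _ ≤ _ := pow_le_pow_left₀ (by norm_num) h4 7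
    nlinarith
  have h3 : (2 * (N : ℝ) + 1) ^ (2 * k * m) ≤ Real.exp ((2 * k * m : ℕ) * (7 + Real.log X)) := by
    rw [Real.exp_nat_mul]
    exact pow_le_pow_left₀ (by positivity) h1 _
  have h4 : δ / 3 = Real.exp (-(Real.log 3 + Real.log (1 / δ))) := by
    rw [← Real.log_mul (by norm_num) (by positivity), Real.exp_neg, Real.exp_log (by positivity)]
    field_simp
  rw [h4]
  refine (mul_le_mul_of_nonneg_right h3 (Real.exp_pos _).le).trans ?_
  rw [← Real.exp_add, Real.exp_le_exp]
  have h5 : Real.log 3 ≤ 2 := by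
    have := Real.log_le_sub_one_of_pos (show (0 : ℝ) < 3 by norm_num)
    linarith
  have h6 : (k : ℝ) * m * (16 + 2 * Real.log X) + Real.log (1 / δ) ≤ θ ^ 2 * T / (288 * k) := by
    rw [le_div_iff₀ (by positivity)]
    have h7 := mul_le_mul_of_nonneg_left hT (sq_nonneg θ)
    refine le_trans (le_of_eq ?_) h7
    field_simp
  push_cast
  linarith

/-- Bernoulli's inequality gives (1-p)^(2k-1) ≥ 1 - (2k-1)p > 1/2. -/
theorem attack_free_probability {k : ℕ} (hk : 1 ≤ k) {p q : ℝ}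
    (hp : p < 1 / (4 * (k : ℝ) - 2)) (hq : q = 1 - (1 - p) ^ (2 * k - 1)) (hp0 : 0 ≤ p) :
    p ≤ 1 ∧ 0 < 1 - 2 * q ∧ 1 - 2 * q ≤ 1 ∧
      (1 + (1 - 2 * q)) / 2 = (1 - p) ^ (2 * k - 1) := by
  have hk' : (1 : ℝ) ≤ k := by exact_mod_cast hk
  have hp1 : p * (4 * k - 2) < 1 := by rwa [lt_div_iff₀ (by linarith)] at hp
  have hp2 : p ≤ 1 := by nlinarith
  have hb := one_add_mul_le_pow (show (-2 : ℝ) ≤ -p by linarith) (2 * k - 1)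
  rw [Nat.cast_sub (by omega)] at hb
  push_cast at hb
  rw [show 1 + -p = 1 - p by ring] at hb
  have hle : (1 - p) ^ (2 * k - 1) ≤ 1 := pow_le_one₀ (by linarith) (by linarith)
  refine ⟨hp2, ?_, ?_, ?_⟩
  · rw [hq]; linarith
  · rw [hq]; linarith
  · rw [hq]; ring

/-! ### Assembly -/

/-- On the event on which the inputs have bounded energy, the attacks have bounded accumulated
response, and the signed sums are bounded below, every estimate is accurate. -/
theorem frobNorm_sub_le_of_good_event {n m r k T : ℕ} (hk : 1 ≤ k) (hr : 1 ≤ r) (hT : 1 ≤ T)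
    {A : Matrix (Fin n) (Fin n) ℝ} {B : Matrix (Fin n) (Fin m) ℝ}
    {C : Matrix (Fin r) (Fin n) ℝ} {D : Matrix (Fin r) (Fin m) ℝ} (hA : specNorm A < 1)
    {x w : ℕ → EuclideanSpace ℝ (Fin n)} {u : ℕ → EuclideanSpace ℝ (Fin m)}
    {y : ℕ → EuclideanSpace ℝ (Fin r)} {z : ℕ → Bool} {θ γ η : ℝ} (hθ : 0 < θ) (hγ : 0 < γ)
    (hη : 0 < η)
    (hx : ∀ t, x (t + 1) = Matrix.toEuclideanLin A (x t) + Matrix.toEuclideanLin B (u t) + w t)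
    (hy : ∀ t, y t = Matrix.toEuclideanLin C (x t) + Matrix.toEuclideanLin D (u t))
    (hw : ∀ s, z s = false → w s = 0)
    (hE : ∑ s ∈ Finset.range T, ‖u s‖ ^ 2 ≤ 12 * m * γ ^ 2 * T)
    (hR : ∑ j ∈ Finset.range T, ‖matCLM (C * A ^ (2 * k - 1)) ((matCLM A ^ j) (x 0))‖
        + ∑ s ∈ Finset.range T, ∑ j ∈ Finset.range T,
          ‖matCLM (C * A ^ (2 * k - 1)) ((matCLM A ^ j) (w s))‖
      ≤ 5 * (specNorm C * specNorm (A ^ (2 * k - 1)) / (1 - specNorm A)) * √(r : ℝ) * η * T)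
    (hS : ∀ Δ : EuclideanSpace ℝ (Fin (2 * k) × Fin m),
      θ * γ * T / 96 * ‖Δ‖ ≤ ∑ t ∈ Finset.Icc (2 * k - 1) (T + 2 * k - 2),
        attackSign k z t * |inner ℝ Δ (stackedVec k u t)|)
    {G : Matrix (Fin r) (Fin (2 * k) × Fin m) ℝ} (hG : IsL1Estimate k T u y G) :
    frobNorm (markovMatrix k A B C D - G) ≤
      960 * (specNorm (A ^ (2 * k - 1)) * specNorm C * √(r : ℝ) / ((1 - specNorm A) * θ)
        * (η / γ + √(m : ℝ) * specNorm B)) := by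
  have hT' : (1 : ℝ) ≤ T := by exact_mod_cast hT
  have hr' : (1 : ℝ) ≤ r := by exact_mod_cast hr
  have ha0 := specNorm_nonneg A
  have hB0 := specNorm_nonneg B
  have ha : 0 < 1 - specNorm A := by linarith
  set M := matCLM (C * A ^ (2 * k - 1))
  set ρ := specNorm C * specNorm (A ^ (2 * k - 1)) with hρ
  have hρ0 : 0 ≤ ρ := mul_nonneg (specNorm_nonneg _) (specNorm_nonneg _)
  have hM : ‖M‖ ≤ ρ := specNorm_mul_le _ _
  set K := ρ / (1 - specNorm A) with hK
  have hK0 : 0 ≤ K := by positivity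
  have hMj (j : ℕ) (v : EuclideanSpace ℝ (Fin m)) :
      ‖M ((matCLM A ^ j) (matCLM B v))‖ ≤ ρ * specNorm A ^ j * (specNorm B * ‖v‖) := by
    have h1 : ‖matCLM B v‖ ≤ specNorm B * ‖v‖ := ContinuousLinearMap.le_opNorm _ _
    have h2 : ‖(matCLM A ^ j) (matCLM B v)‖ ≤ specNorm A ^ j * (specNorm B * ‖v‖) :=
      (ContinuousLinearMap.le_opNorm _ _).trans
        (mul_le_mul (norm_pow_le_pow_norm _ _) h1 (norm_nonneg _) (by positivity))
    refine (ContinuousLinearMap.le_opNorm _ _).trans ?_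
    rw [mul_assoc]
    exact mul_le_mul hM h2 (norm_nonneg _) hρ0
  -- Input and attack together form one increment; the input part is then bounded pathwise by the
  -- geometric series and the energy.
  have hrec := sum_norm_recursion_le (matCLM A) M x (fun s => matCLM B (u s) + w s)
    (fun t => by rw [hx, add_assoc]; rfl) T 0
  simp only [Finset.range_zero, Finset.sum_empty, add_zero, zero_add] at hrec
  have hsplit : ∑ s ∈ Finset.range T, ∑ j ∈ Finset.range T,
        ‖M ((matCLM A ^ j) (matCLM B (u s) + w s))‖
      ≤ K * specNorm B * ∑ s ∈ Finset.range T, ‖u s‖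
        + ∑ s ∈ Finset.range T, ∑ j ∈ Finset.range T, ‖M ((matCLM A ^ j) (w s))‖ := by
    rw [Finset.mul_sum, ← Finset.sum_add_distrib]
    refine Finset.sum_le_sum fun s _ => ?_
    calc _ ≤ ∑ j ∈ Finset.range T, (ρ * specNorm A ^ j * (specNorm B * ‖u s‖)
          + ‖M ((matCLM A ^ j) (w s))‖) := by
          refine Finset.sum_le_sum fun j _ => ?_
          rw [map_add, map_add]
          exact (norm_add_le _ _).trans (add_le_add (hMj j _) le_rfl)
      _ ≤ _ := by
          rw [Finset.sum_add_distrib, ← Finset.sum_mul, mul_assoc K]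
          have := sum_mul_pow_le_div hρ0 ha0 hA T
          gcongr
  have hu : ∑ s ∈ Finset.range T, ‖u s‖ ≤ 4 * √(m : ℝ) * γ * T := by
    refine sum_le_of_sum_sq_le _ _ (c := T) (by simp) hE (by positivity) ?_
    have hsm : √(m : ℝ) ^ 2 = m := Real.sq_sqrt (Nat.cast_nonneg m)
    rw [mul_pow, mul_pow, mul_pow, hsm]
    have : 0 ≤ (m : ℝ) * γ ^ 2 * T ^ 2 := by positivity
    linarith
  have hsr : 1 ≤ √(r : ℝ) := Real.one_le_sqrt.2 hr'
  have hsum : ∑ s ∈ Finset.range T, ‖M (x s)‖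
      ≤ 5 * K * √(r : ℝ) * T * (η + √(m : ℝ) * specNorm B * γ) := by
    have h1 : K * specNorm B * ∑ s ∈ Finset.range T, ‖u s‖
        ≤ K * specNorm B * (4 * √(m : ℝ) * γ * T) := by gcongr
    have h2 : K * specNorm B * (4 * √(m : ℝ) * γ * T)
        ≤ 5 * K * √(r : ℝ) * T * (√(m : ℝ) * specNorm B * γ) := by
      have h3 : 0 ≤ K * specNorm B * √(m : ℝ) * γ * T := by positivity
      have h4 : 4 * (K * specNorm B * √(m : ℝ) * γ * T)
          ≤ (5 * √(r : ℝ)) * (K * specNorm B * √(m : ℝ) * γ * T) :=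
        mul_le_mul_of_nonneg_right (by linarith) h3
      linarith
    linarith
  have hfrob := mul_frobNorm_le_of_rows (markovMatrix k A B C D - G) (κ := θ * γ * T / 96)
    (by positivity) (T := T) (fun s => M (x s)) (fun i =>
      (hS _).trans (signed_sum_row_le hk hx hy hw hG i))
  have h5 : θ * γ * T / 96 * frobNorm (markovMatrix k A B C D - G)
      ≤ θ * γ * T / 96 * (960 * (specNorm (A ^ (2 * k - 1)) * specNorm C * √(r : ℝ)
        / ((1 - specNorm A) * θ) * (η / γ + √(m : ℝ) * specNorm B))) := by
    -- The constant is 960 = 96 · 2 · 5: the lower bound, the basic inequality, the response bound.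
    refine hfrob.trans ((mul_le_mul_of_nonneg_left hsum (by norm_num)).trans (le_of_eq ?_))
    rw [hK, hρ]
    field_simp
    ring
  exact le_of_mul_le_mul_left h5 (by positivity)

theorem theorem3 :
    ∃ c₁ c₂ : ℝ, 0 < c₁ ∧ 0 < c₂ ∧
      ∀ (n m r k : ℕ) (_ : 1 ≤ k)
        (A : Matrix (Fin n) (Fin n) ℝ) (B : Matrix (Fin n) (Fin m) ℝ)
        (C : Matrix (Fin r) (Fin n) ℝ) (D : Matrix (Fin r) (Fin m) ℝ)
        (_ : specNorm A < 1)
        (η γ p q δ : ℝ) (_ : 0 < η) (_ : 0 < γ)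
        (_ : 0 ≤ p) (_ : p < 1 / (4 * (k : ℝ) - 2)) (_ : q = 1 - (1 - p) ^ (2 * k - 1))
        (_ : 0 < δ) (_ : δ ≤ 1)
        (Ω : Type*) [MeasurableSpace Ω] (P : Measure Ω) [IsProbabilityMeasure P]
        (x w : ℕ → Ω → EuclideanSpace ℝ (Fin n)) (u : ℕ → Ω → EuclideanSpace ℝ (Fin m))
        (y : ℕ → Ω → EuclideanSpace ℝ (Fin r)) (ξ : ℕ → Ω → Bool)
        -- measurability of the initial state, attacks, inputs and attack indicators
        (_ : Measurable (x 0)) (_ : ∀ t, Measurable (w t)) (_ : ∀ t, Measurable (u t))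
        (_ : ∀ t, Measurable (ξ t))
        -- the system
        (_ : ∀ t ω, x (t + 1) ω =
          Matrix.toEuclideanLin A (x t ω) + Matrix.toEuclideanLin B (u t ω) + w t ω)
        (_ : ∀ t ω, y t ω = Matrix.toEuclideanLin C (x t ω) + Matrix.toEuclideanLin D (u t ω))
        -- sub-Gaussian initial state and conditionally sub-Gaussian attacks
        (_ : vecPsi2Norm (x 0) P ≤ ENNReal.ofReal η)
        (_ : ∀ t, CondPsi2Le P (w t) (history (x 0) w t) η)
        -- attack times
        (_ : iIndepFun ξ P)
        (_ : ∀ t, P {ω | ξ t ω = true} = ENNReal.ofReal p)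
        (_ : ∀ t, IndepFun (ξ t) (history (x 0) w t) P)
        (_ : ∀ t ω, ξ t ω = false → w t ω = 0)
        -- independent Gaussian inputs, independent of the attack times
        (_ : iIndepFun u P)
        (_ : ∀ t, HasLaw (u t) (multivariateGaussian 0 (γ ^ 2 • (1 : Matrix (Fin m) (Fin m) ℝ))) P)
        (_ : IndepFun (fun ω t => u t ω) (fun ω t => ξ t ω) P)
        -- the sample size
        (T : ℕ) (_ : c₁ ≤ (T : ℝ))
        (_ : c₁ * ((k : ℝ) / (1 - 2 * q) ^ 2 *
          ((k : ℝ) * m * Real.log ((k : ℝ) * m / (1 - 2 * q)) + Real.log ((r : ℝ) / δ))) ≤ (T : ℝ)),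
        q < 1 / 2 ∧
        ∃ E : Set Ω, MeasurableSet E ∧ ENNReal.ofReal (1 - δ) ≤ P E ∧
          ∀ ω ∈ E, ∀ G : Matrix (Fin r) (Fin (2 * k) × Fin m) ℝ,
            IsL1Estimate k T (fun t => u t ω) (fun t => y t ω) G →
            frobNorm (markovMatrix k A B C D - G) ≤
              c₂ * (specNorm (A ^ (2 * k - 1)) * specNorm C * √(r : ℝ) /
                ((1 - specNorm A) * (1 - 2 * q)) * (η / γ + √(m : ℝ) * specNorm B)) ∧
            frobNorm (markovMatrix k A B C D - G) ≤
              c₂ * (specNorm A ^ (2 * k - 1) * specNorm C * √(r : ℝ) /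
                ((1 - specNorm A) * (1 - 2 * q)) * (η / γ + √(m : ℝ) * specNorm B)) := by
  refine ⟨40000, 960, by norm_num, by norm_num, ?_⟩
  intro n m r k hk A B C D hA η γ p q δ hη hγ hp0 hp hq hδ hδ1 Ω _ P _ x w u y ξ hx0 hw hu hξ hx hy
    hx0η hwη hξind hξp _ hξw huind hlaw huξ T hT1 hT
  obtain ⟨hp1, hθ0, hθ1, hθ⟩ := attack_free_probability hk hp hq hp0
  set θ := 1 - 2 * q with hθdef
  refine ⟨by linarith, ?_⟩
  have ha0 := specNorm_nonneg A
  have ha : 0 < 1 - specNorm A := by linarith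
  -- the second bound is weaker than the first
  suffices h : ∃ E : Set Ω, MeasurableSet E ∧ ENNReal.ofReal (1 - δ) ≤ P E ∧
      ∀ ω ∈ E, ∀ G : Matrix (Fin r) (Fin (2 * k) × Fin m) ℝ,
        IsL1Estimate k T (fun t => u t ω) (fun t => y t ω) G →
        frobNorm (markovMatrix k A B C D - G) ≤
          960 * (specNorm (A ^ (2 * k - 1)) * specNorm C * √(r : ℝ) /
            ((1 - specNorm A) * θ) * (η / γ + √(m : ℝ) * specNorm B)) by
    obtain ⟨E, hEm, hEP, hE⟩ := h
    refine ⟨E, hEm, hEP, fun ω hω G hG => ⟨hE ω hω G hG, (hE ω hω G hG).trans ?_⟩⟩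
    have := specNorm_nonneg B
    have := specNorm_nonneg C
    have := specNorm_pow_le A (2 * k - 1)
    gcongr
  have hrhs : 0 ≤ 960 * (specNorm (A ^ (2 * k - 1)) * specNorm C * √(r : ℝ) /
      ((1 - specNorm A) * θ) * (η / γ + √(m : ℝ) * specNorm B)) := by
    have := specNorm_nonneg B
    have := specNorm_nonneg C
    have := specNorm_nonneg (A ^ (2 * k - 1))
    positivity
  rcases Nat.eq_zero_or_pos m with rfl | hm
  · refine ⟨Set.univ, MeasurableSet.univ, by simp [hδ.le], fun ω _ G _ => ?_⟩
    refine le_trans (le_of_eq ?_) hrhs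
    simp [frobNorm]
  rcases Nat.eq_zero_or_pos r with rfl | hr
  · refine ⟨Set.univ, MeasurableSet.univ, by simp [hδ.le], fun ω _ G _ => ?_⟩
    refine le_trans (le_of_eq ?_) hrhs
    simp [frobNorm]
  have hk' : (1 : ℝ) ≤ k := by exact_mod_cast hk
  have hm' : (1 : ℝ) ≤ m := by exact_mod_cast hm
  have hkm : (1 : ℝ) ≤ (k : ℝ) * m := by nlinarith
  have hsize := sample_size_le hk hm hθ0 hθ1 hδ hδ1 (by exact_mod_cast hr : (1 : ℝ) ≤ r) hT1 hT
  have hT0 : 1 ≤ T := by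
    have : (1 : ℝ) ≤ T := by linarith
    exact_mod_cast this
  have hlam0 : 0 ≤ Real.log (1 / δ) := Real.log_nonneg (by rw [le_div_iff₀ hδ]; linarith)
  have hℓ0 : 0 ≤ Real.log ((k : ℝ) * m / θ) := Real.log_nonneg (by rw [le_div_iff₀ hθ0]; linarith)
  -- This weak consequence of the sample size yields both T ≥ 4k and e^(-T) ≤ δ/3.
  have hbase : (k : ℝ) * (16 + Real.log (1 / δ)) ≤ T := by
    refine le_trans ?_ hsize
    have h1 : (k : ℝ) ≤ k / θ ^ 2 := by
      rw [le_div_iff₀ (by positivity)]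
      have : θ ^ 2 ≤ 1 := by nlinarith
      nlinarith
    have h2 : 16 + Real.log (1 / δ)
        ≤ (k : ℝ) * m * (16 + 2 * Real.log ((k : ℝ) * m / θ)) + Real.log (1 / δ) := by nlinarith
    have h3 := mul_le_mul h1 h2 (by linarith) (by positivity)
    have h4 : 0 ≤ (k : ℝ) * (16 + Real.log (1 / δ)) := by positivity
    linarith
  have hT4k : 4 * k ≤ T := by
    have : 4 * (k : ℝ) ≤ T := by nlinarith
    exact_mod_cast this
  have hexpT : Real.exp (-(T : ℝ)) ≤ δ / 3 := by
    have h1 : Real.log 3 + Real.log (1 / δ) ≤ T := by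
      have := Real.log_le_sub_one_of_pos (show (0 : ℝ) < 3 by norm_num)
      nlinarith
    have h2 : δ / 3 = Real.exp (-(Real.log 3 + Real.log (1 / δ))) := by
      rw [← Real.log_mul (by norm_num) (by positivity), Real.exp_neg, Real.exp_log (by positivity)]
      field_simp
    rw [h2, Real.exp_le_exp]
    linarith
  set ρ := specNorm C * specNorm (A ^ (2 * k - 1)) with hρ
  have hρ0 : 0 ≤ ρ := mul_nonneg (specNorm_nonneg _) (specNorm_nonneg _)
  set M := matCLM (C * A ^ (2 * k - 1)) with hM
  have hMj (j : ℕ) : ‖M.comp (matCLM A ^ j)‖ ≤ ρ * specNorm A ^ j :=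
    (ContinuousLinearMap.opNorm_comp_le _ _).trans
      (mul_le_mul (specNorm_mul_le _ _) (norm_pow_le_pow_norm _ _) (norm_nonneg _) hρ0)
  set N := ⌈260 * ((k : ℝ) * m / θ)⌉₊ with hN
  let bad₁ := {ω | 12 * m * γ ^ 2 * T < ∑ s ∈ Finset.range (T + 2 * k - 1), ‖u s ω‖ ^ 2}
  let bad₂ := {ω | 5 * (ρ / (1 - specNorm A)) * √(r : ℝ) * η * T
    < ∑ j ∈ Finset.range T, ‖M.comp (matCLM A ^ j) (x 0 ω)‖
      + ∑ s ∈ Finset.range T, ∑ j ∈ Finset.range T, ‖M.comp (matCLM A ^ j) (w s ω)‖}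
  let bad₃ := {ω | ∃ v : EuclideanSpace ℝ (Fin (2 * k) × Fin m),
        (∃ z : Fin (2 * k) × Fin m → ℤ, (∀ c, |z c| ≤ N) ∧ ∀ c, v c = z c) ∧
        ∑ t ∈ Finset.Icc (2 * k - 1) (T + 2 * k - 2), attackSign k (fun s => ξ s ω) t
          * |inner ℝ v (stackedVec k (fun s => u s ω) t)| < θ * γ * T / 24 * ‖v‖}
  have hP₁ : P bad₁ ≤ ENNReal.ofReal (δ / 3) :=
    measure_input_energy_gt_le hm hγ hu huind hlaw (by omega) hexpT
  have hP₂ : P bad₂ ≤ ENNReal.ofReal (δ / 3) :=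
    measure_attack_response_gt_le hr hx0 hw hη hx0η hwη (fun j => M.comp (matCLM A ^ j)) hρ0 ha0 hA
      hMj T hT0 hexpT
  have hP₃ : P bad₃ ≤ ENNReal.ofReal (δ / 3) :=
    (measure_exists_signed_sum_lt_le hk hT4k hγ hu huind hlaw hξ hξind hp0 hp1 hξp huξ hθ hθ0 hθ1
      N).trans (ENNReal.ofReal_le_ofReal (card_mul_exp_le hk hm hθ0 hθ1 hδ
        (Nat.ceil_lt_add_one (by positivity)).le hsize))
  have hP : P (bad₁ ∪ bad₂ ∪ bad₃) ≤ ENNReal.ofReal δ := by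
    refine (measure_union_le _ _).trans ((add_le_add (measure_union_le _ _) le_rfl).trans ?_)
    refine (add_le_add (add_le_add hP₁ hP₂) hP₃).trans (le_of_eq ?_)
    rw [← ENNReal.ofReal_add (by positivity) (by positivity),
      ← ENNReal.ofReal_add (by positivity) (by positivity)]
    congr 1
    ring
  -- Passing to a measurable hull of the bad set keeps its measure. The set does not involve `G`, so
  -- one event serves all minimizers.
  refine ⟨(toMeasurable P (bad₁ ∪ bad₂ ∪ bad₃))ᶜ, (measurableSet_toMeasurable _ _).compl, ?_, ?_⟩
  · rw [measure_compl (measurableSet_toMeasurable _ _) (measure_ne_top _ _), measure_toMeasurable,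
      measure_univ, ENNReal.ofReal_sub _ hδ.le, ENNReal.ofReal_one]
    exact tsub_le_tsub_left hP 1
  · intro ω hω G hG
    have hgood : ω ∉ bad₁ ∪ bad₂ ∪ bad₃ := fun h => hω (subset_toMeasurable _ _ h)
    rw [Set.mem_union, Set.mem_union, not_or, not_or] at hgood
    obtain ⟨⟨hg₁, hg₂⟩, hg₃⟩ := hgood
    have hg₁' : ∑ s ∈ Finset.range (T + 2 * k - 1), ‖u s ω‖ ^ 2 ≤ 12 * m * γ ^ 2 * T :=
      not_lt.1 hg₁
    have hg₂' : ∑ j ∈ Finset.range T, ‖M.comp (matCLM A ^ j) (x 0 ω)‖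
        + ∑ s ∈ Finset.range T, ∑ j ∈ Finset.range T, ‖M.comp (matCLM A ^ j) (w s ω)‖
        ≤ 5 * (ρ / (1 - specNorm A)) * √(r : ℝ) * η * T := not_lt.1 hg₂
    refine frobNorm_sub_le_of_good_event hk hr hT0 hA (z := fun s => ξ s ω) (x := fun t => x t ω)
      (w := fun t => w t ω) (u := fun t => u t ω) (y := fun t => y t ω) hθ0 hγ hη
      (fun t => hx t ω) (fun t => hy t ω) (fun s hs => hξw s ω hs) ?_ hg₂' ?_ hG
    · refine le_trans (Finset.sum_le_sum_of_subset_of_nonneg (Finset.range_mono (by omega))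
        fun _ _ _ => by positivity) hg₁'
    · refine le_signed_sum_of_energy hk hm hT0 hθ0 hθ1 hγ _ _ (abs_attackSign k _) hg₁'
        (Nat.le_ceil _) fun v hv => ?_
      by_contra hlt
      exact hg₃ ⟨v, hv, not_le.1 hlt⟩
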